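/- Fix $h\in\mathbb C$ with $0<|h|<1$ and put $Q=h^2$ (so $Q^{1/2}=h$), $q=Q^6$, $q^{1/2}=h^6$, $q^{1/4}=h^3$, and $a_0=\alpha_0^6$. Write $(a;q)_n=\prod_{i=0}^{n-1}(1-aq^i)$, $(a;q)_\infty=\prod_{i\ge0}(1-aq^i)$, $\Theta(a;q)=(a;q)_\infty(qa^{-1};q)_\infty$, $\Gamma(a;p,q)=\prod_{i,j\ge0}\frac{1-p^{i+1}q^{j+1}a^{-1}}{1-p^iq^ja}$ and ${}_1\varphi_1(a;b;q,z)=\sum_{n\ge0}\frac{(a;q)_n}{(b;q)_n(q;q)_n}(-1)^nq^{n(n-1)/2}z^n$. **Action.** On the parameters $\alpha_i$ ($i\in\mathbb Z/3$), $\gamma$ and the variables $\tau_i,\overline\tau_i$ consider the transformations (trivial on what is not listed), with $u_i=Q^{-2}\gamma^{-4}\alpha_i^6$, $u_i^{1/2}=Q^{-1}\gamma^{-2}\alpha_i^3$, $v_i=Q^{2}\gamma^{4}\alpha_i^6$, $v_i^{1/2}=Q\gamma^{2}\alpha_i^3$: - $s_i$: $\alpha_i\mapsto\alpha_i^{-1}$,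 $\alpha_j\mapsto\alpha_j\alpha_i$ $(j\ne i)$, $\tau_i\mapsto\dfrac{u_i\tau_{i+1}\overline\tau_{i-1}+\overline\tau_{i+1}\tau_{i-1}}{u_i^{1/2}\,\overline\tau_i}$, $\overline\tau_i\mapsto\dfrac{v_i\overline\tau_{i+1}\tau_{i-1}+\tau_{i+1}\overline\tau_{i-1}}{v_i^{1/2}\,\tau_i}$; - $\pi$: $\alpha_i\mapsto\alpha_{i+1}$, $\tau_i\mapsto\tau_{i+1}$, $\overline\tau_i\mapsto\overline\tau_{i+1}$; - $w_0$: $\gamma\mapsto\gamma^{-1}$, $\overline\tau_i\mapsto\dfrac{\alpha_{i+1}^2\left(\overline\tau_i\tau_{i+1}\tau_{i+2}+u_{i-1}\tau_i\overline\tau_{i+1}\tau_{i+2}+u_{i+1}^{-1}\tau_i\tau_{i+1}\overline\tau_{i+2}\right)}{\alpha_{i+2}^2\,\overline\tau_{i+1}\overline\tau_{i+2}}$; - $r$: $\gamma\mapsto Q^{-1}\gamma^{-1}$, $\tau_i\leftrightarrow\overline\tau_i$. Composition is composition of substitutions of functions of the variables (in $ww'$ the substitution $w$ is applied to the expressions given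 by $w'$). Put $R_1=\pi^2s_1$ and $T_4=rw_0$. For a family of functions $\tau_N^k(\alpha_0)$ $(k,N\in\mathbb Z)$ and for $k,N,\alpha_0$, let the *site* $(k,N)$ be the point with $\alpha_0,\alpha_1,\alpha_2,\gamma$ equal to $Q^{k/2}\alpha_0,\ Q^{1/2}(Q^{k/2}\alpha_0)^{-1},\ Q^{1/2},\ Q^N$ (that is, $\alpha_2=Q^{1/2}$ and $\gamma=1$ at the origin), with $(\tau_0,\tau_1,\tau_2)=(\tau^{k-2}_N,\tau^k_N,\tau^{k-1}_N)(\alpha_0)$ and $(\overline\tau_0,\overline\tau_1,\overline\tau_2)=(\tau^{k-2}_{N+1},\tau^k_{N+1},\tau^{k-1}_{N+1})(\alpha_0)$. The family is *consistent with $\langle R_1,T_4\rangle$ on $D\subset\mathbb C^\times$* if for all $\alpha_0\in D$ and $k,N\in\mathbb Z$: $\tau_N^k(\alpha_0)=\tau_N^0(Q^{k/2}\alpha_0)$, and $R_1^{\pm1}$ takes the site $(k,N)$ to the site $(k\pm1,N)$ and $T_4^{\pm1}$ takes it to the site $(k,N\pm1)$, the formulas above being read with denominators cleared (after multiplication by the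 denominators). It is a *family of hypergeometric $\tau$ functions of $q$-P$_{\rm II}$ on $D$* if moreover $\tau_N^k(\alpha_0)=0$ for all $N<0$, $k\in\mathbb Z$, $\alpha_0\in D$. **Explicit functions.** For $A,B:\mathbb C\to\mathbb C$ with $A(Q^{1/2}\alpha_0)=A(\alpha_0)$ and $B(Q^{1/2}\alpha_0)=B(\alpha_0)$, put $A_k=A(Q^{k/2}\alpha_0)$, $B_k=B(Q^{k/2}\alpha_0)$ (so $A_{k+1}=A_k$, $B_{k+1}=B_k$), $$G_k=A_k\,\Theta\!\left(ia_0q^{\frac{2k+1}4};q^{\frac12}\right){}_1\varphi_1\!\left(0;-q^{\frac12};q^{\frac12},-ia_0q^{\frac{3+2k}4}\right)+B_k\,\Theta\!\left(-ia_0q^{\frac{2k+1}4};q^{\frac12}\right){}_1\varphi_1\!\left(0;-q^{\frac12};q^{\frac12},ia_0q^{\frac{3+2k}4}\right),$$ $\phi_N^k=\det(G_{k+2i-j-1})_{i,j=1}^N$ for $N>0$, $\phi_0^k=1$, $\phi_N^k=0$ for $N<0$, $g_k=\Gamma(Q^{\frac{2k+3}2}\alpha_0^2;Q,Q)\,\Gamma(Q^{-\frac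 k2}\alpha_0^{-1};Q,Q)\,\Gamma(Q^{\frac{-k+3}2}\alpha_0^{-1};Q,Q)$ and $$\tau_N^k=(-1)^{\frac{N(N-1)}2}Q^{N(N-1)(k+N)}\alpha_0^{2N(N-1)}\,\frac{g_k}{\Theta(Q^{3k+1}\alpha_0^6;Q^3)^N}\,\phi_N^k.\qquad(*)$$ Call $\alpha_0$ *generic* if $\alpha_0\neq0$ and $\alpha_0\ne h^j$, $\alpha_0^2\neq h^{2j+1}$, $\alpha_0^6\ne h^{6j-2}$ for all $j\in\mathbb Z$ (so that no factor $\Gamma$ or $\Theta$ in $(*)$ has a zero or a pole, for any $k$). **Theorem.** 1. For $\alpha_0\ne0$, $G_{k+1}-G_k+a_0^{-2}q^{-k}G_{k-1}=0$ for all $k\in\mathbb Z$. If moreover $\Theta(\pm ia_0q^{1/4};q^{1/2})\ne0$ (both signs), every solution $(G_k)_{k\in\mathbb Z}$ of this relation is of the above form with constants $A_k=a$, $B_k=b$. 2. For all such $A,B$, the functions $(*)$ are hypergeometric $\tau$ functions of $q$-P$_{\rm II}$ on the set of generic $\alpha_0$. 3. Conversely, let $D$ be a set of generic $\alpha_0$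 with $\Theta(\pm ia_0q^{1/4};q^{1/2})\neq0$ (both signs) such that $Q^{1/2}\alpha_0\in D\iff\alpha_0\in D$, and let $\tau_N^k$ be hypergeometric $\tau$ functions of $q$-P$_{\rm II}$ on $D$, normalized by $\tau_0^k=g_k$ and with $\tau_N^k(\alpha_0)\neq0$ for $N\ge0$, $k\in\mathbb Z$, $\alpha_0\in D$. Then there are $A,B$ as above such that $(*)$ holds for all $k,N\in\mathbb Z$ and $\alpha_0\in D$. -/

import Mathlib

open Complex

noncomputable section

namespace QPainleve

/-- The finite `q`-shifted factorial `(a;q)_n = ∏_{i<n} (1 - a q^i)`. -/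
def qPoch (a q : ℂ) (n : ℕ) : ℂ := ∏ i ∈ Finset.range n, (1 - a * q ^ i)

/-- The infinite `q`-shifted factorial `(a;q)_∞` (used for `|q| < 1`). -/
def qPochInf (a q : ℂ) : ℂ := ∏' i : ℕ, (1 - a * q ^ i)

/-- The double infinite product `(a;p,q)_∞ = ∏_{i,j ≥ 0} (1 - p^i q^j a)` (used for `|p|,|q| < 1`). -/
def qPochInf₂ (a p q : ℂ) : ℂ := ∏' ij : ℕ × ℕ, (1 - p ^ ij.1 * q ^ ij.2 * a)

/-- The theta function `Θ(a;q) = (a;q)_∞ (q a⁻¹;q)_∞`. -/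
def Theta (a q : ℂ) : ℂ := qPochInf a q * qPochInf (q * a⁻¹) q

/-- The elliptic gamma function `Γ(a;p,q) = (p q a⁻¹;p,q)_∞ / (a;p,q)_∞`. -/
def ellGamma (a p q : ℂ) : ℂ := qPochInf₂ (p * q * a⁻¹) p q / qPochInf₂ a p q

/-- The basic hypergeometric series `₁φ₁(a; b; q, z)`. -/
def onePhiOne (a b q z : ℂ) : ℂ :=
  ∑' n : ℕ, qPoch a q n / (qPoch b q n * qPoch q q n) * ((-1) ^ n * q ^ (n * (n - 1) / 2)) * z ^ n

/-! ### The birational action on parameters and `τ` variables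

The index set `ℤ/3ℤ` is `Fin 3`, whose addition is modulo `3`. The parameters are written through
`α_i`, `γ`, `Q` with `a_i = α_i^6`, `c = γ^6`, `q = Q^6`, so that `q^{1/3} = Q^2`,
`c^{2/3} = γ^4`, `a_i^{1/3} = α_i^2`.

A transformation `w` acts on a function of the variables by `(w.F)(x) = F(x.w)`; here it is given
as the map (or graph) `p ↦ p.w` on values of the variables. Hence a product `w w'` acts on points
by applying `w` first and then `w'`. -/

/-- Values of the parameters `α_i, γ` and of the variables `τ_i`, `\overline{τ}_i`. -/
@[ext]
structure TauPoint where
  α : Fin 3 → ℂ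
  γ : ℂ
  τ : Fin 3 → ℂ
  τb : Fin 3 → ℂ

/-- `u_i = q^{-1/3} c^{-2/3} a_i`. -/
def TauPoint.u (Q : ℂ) (p : TauPoint) (i : Fin 3) : ℂ := (Q ^ 2)⁻¹ * (p.γ ^ 4)⁻¹ * p.α i ^ 6

/-- `u_i^{1/2}`. -/
def TauPoint.uSqrt (Q : ℂ) (p : TauPoint) (i : Fin 3) : ℂ := Q⁻¹ * (p.γ ^ 2)⁻¹ * p.α i ^ 3

/-- `v_i = q^{1/3} c^{2/3} a_i`. -/
def TauPoint.v (Q : ℂ) (p : TauPoint) (i : Fin 3) : ℂ := Q ^ 2 * p.γ ^ 4 * p.α i ^ 6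

/-- `v_i^{1/2}`. -/
def TauPoint.vSqrt (Q : ℂ) (p : TauPoint) (i : Fin 3) : ℂ := Q * p.γ ^ 2 * p.α i ^ 3

/-- The Cartan matrix of type `A_2^{(1)}`. -/
def cartan (i j : Fin 3) : ℤ := if i = j then 2 else -1

/-- The diagram rotation: `π(α_i) = α_{i+1}`, `π(τ_i) = τ_{i+1}`,
`π(\overline{τ}_i) = \overline{τ}_{i+1}`. -/
def piMap (p : TauPoint) : TauPoint where
  α i := p.α (i + 1)
  γ := p.γ
  τ i := p.τ (i + 1)
  τb i := p.τb (i + 1)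

/-- `r` exchanges `τ_i` and `\overline{τ}_i`, fixes `α_i`, and sends `c` to `q^{-1} c^{-1}`. -/
def rMap (Q : ℂ) (p : TauPoint) : TauPoint where
  α := p.α
  γ := Q⁻¹ * p.γ⁻¹
  τ := p.τb
  τb := p.τ

/-- The reflection `s_i` as a rational map. -/
def sMap (Q : ℂ) (i : Fin 3) (p : TauPoint) : TauPoint where
  α j := p.α j * p.α i ^ (-cartan i j)
  γ := p.γ
  τ j := if j = i then
      (p.u Q i * p.τ (i + 1) * p.τb (i - 1) + p.τb (i + 1) * p.τ (i - 1))
        / (p.uSqrt Q i * p.τb i)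
    else p.τ j
  τb j := if j = i then
      (p.v Q i * p.τb (i + 1) * p.τ (i - 1) + p.τ (i + 1) * p.τb (i - 1))
        / (p.vSqrt Q i * p.τ i)
    else p.τb j

/-- `p' = p.s_i`, with denominators cleared so that it is meaningful for all values of the
`τ` variables. -/
def SRel (Q : ℂ) (i : Fin 3) (p p' : TauPoint) : Prop :=
  (∀ j, p'.α j = p.α j * p.α i ^ (-cartan i j)) ∧ p'.γ = p.γ ∧
  (∀ j, j ≠ i → p'.τ j = p.τ j ∧ p'.τb j = p.τb j) ∧
  p.uSqrt Q i * p.τb i * p'.τ i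
    = p.u Q i * p.τ (i + 1) * p.τb (i - 1) + p.τb (i + 1) * p.τ (i - 1) ∧
  p.vSqrt Q i * p.τ i * p'.τb i
    = p.v Q i * p.τb (i + 1) * p.τ (i - 1) + p.τ (i + 1) * p.τb (i - 1)

/-- The involution `w_0` as a rational map (`c` is sent to `c⁻¹`). -/
def w0Map (Q : ℂ) (p : TauPoint) : TauPoint where
  α := p.α
  γ := p.γ⁻¹
  τ := p.τ
  τb i :=
    p.α (i + 1) ^ 2 * (p.τb i * p.τ (i + 1) * p.τ (i + 2)
        + p.u Q (i - 1) * p.τ i * p.τb (i + 1) * p.τ (i + 2)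
        + (p.u Q (i + 1))⁻¹ * p.τ i * p.τ (i + 1) * p.τb (i + 2))
      / (p.α (i + 2) ^ 2 * p.τb (i + 1) * p.τb (i + 2))

/-- `p' = p.w_0`, with denominators cleared. -/
def W0Rel (Q : ℂ) (p p' : TauPoint) : Prop :=
  p'.α = p.α ∧ p'.γ = p.γ⁻¹ ∧ p'.τ = p.τ ∧
  ∀ i, p.α (i + 2) ^ 2 * p.τb (i + 1) * p.τb (i + 2) * p'.τb i
    = p.α (i + 1) ^ 2 * (p.τb i * p.τ (i + 1) * p.τ (i + 2)
        + p.u Q (i - 1) * p.τ i * p.τb (i + 1) * p.τ (i + 2)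
        + (p.u Q (i + 1))⁻¹ * p.τ i * p.τ (i + 1) * p.τb (i + 2))

/-- Where the denominators do not vanish, `SRel` is the graph of the rational map `s_i`. -/
theorem sRel_iff {Q : ℂ} {i : Fin 3} {p p' : TauPoint} (hQ : Q ≠ 0) (hγ : p.γ ≠ 0)
    (hα : p.α i ≠ 0) (hτ : p.τ i ≠ 0) (hτb : p.τb i ≠ 0) :
    SRel Q i p p' ↔ p' = sMap Q i p := by
  have hu : p.uSqrt Q i * p.τb i ≠ 0 := by
    unfold TauPoint.uSqrt; positivity
  have hv : p.vSqrt Q i * p.τ i ≠ 0 := by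
    unfold TauPoint.vSqrt; positivity
  constructor
  · rintro ⟨h1, h2, h3, h4, h5⟩
    ext j
    · exact h1 j
    · exact h2
    · by_cases hj : j = i
      · subst hj
        simp only [sMap, if_true]
        rw [eq_div_iff hu, ← h4]; ring
      · simp only [sMap, if_neg hj]; exact (h3 j hj).1
    · by_cases hj : j = i
      · subst hj
        simp only [sMap, if_true]
        rw [eq_div_iff hv, ← h5]; ring
      · simp only [sMap, if_neg hj]; exact (h3 j hj).2
  · rintro rfl
    refine ⟨fun j => rfl, rfl, fun j hj => ?_, ?_, ?_⟩
    · simp [sMap, hj]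
    · simp only [sMap, if_true]; exact mul_div_cancel₀ _ hu
    · simp only [sMap, if_true]; exact mul_div_cancel₀ _ hv

/-- Where the denominators do not vanish, `W0Rel` is the graph of the rational map `w_0`. -/
theorem w0Rel_iff {Q : ℂ} {p p' : TauPoint} (hα : ∀ i, p.α i ≠ 0) (hτb : ∀ i, p.τb i ≠ 0) :
    W0Rel Q p p' ↔ p' = w0Map Q p := by
  have hd : ∀ i, p.α (i + 2) ^ 2 * p.τb (i + 1) * p.τb (i + 2) ≠ 0 := fun i =>
    mul_ne_zero (mul_ne_zero (pow_ne_zero _ (hα _)) (hτb _)) (hτb _)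
  constructor
  · rintro ⟨h1, h2, h3, h4⟩
    ext j
    · exact congrFun h1 j
    · exact h2
    · exact congrFun h3 j
    · simp only [w0Map]
      rw [eq_div_iff (hd j), ← h4 j]; ring
  · rintro rfl
    exact ⟨rfl, rfl, rfl, fun i => mul_div_cancel₀ _ (hd i)⟩

/-- `p' = p.R_1`, where `R_1 = π² s_1`. -/
def R1Rel (Q : ℂ) (p p' : TauPoint) : Prop := SRel Q 1 (piMap (piMap p)) p'

/-- `p' = p.R_1⁻¹`, where `R_1⁻¹ = s_1 π`. -/
def R1InvRel (Q : ℂ) (p p' : TauPoint) : Prop := ∃ x, SRel Q 1 p x ∧ p' = piMap x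

/-- `p' = p.T_4`, where `T_4 = r w_0`. -/
def T4Rel (Q : ℂ) (p p' : TauPoint) : Prop := W0Rel Q (rMap Q p) p'

/-- `p' = p.T_4⁻¹`, where `T_4⁻¹ = w_0 r`. -/
def T4InvRel (Q : ℂ) (p p' : TauPoint) : Prop := ∃ x, W0Rel Q p x ∧ p' = rMap Q x

/-! ### `τ` functions of `q`-P_II

Throughout, `h` stands for `Q^{1/2}`, so that `Q = h^2`, `q = Q^6 = h^{12}`, `q^{1/2} = h^6` and
`q^{1/4} = h^3`. A family of `τ` functions is `τ : ℤ → ℤ → ℂ → ℂ`, where `τ k N α₀` is the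
value of `τ_N^k` at the parameter `α₀`. -/

/-- The parameters and `τ` variables at the lattice site `(k, N)`: with `α_2 = Q^{1/2}` and `γ = 1`
at the origin, `R_1^k T_4^N` sends `(α_0, α_1, α_2, γ)` to
`(Q^{k/2} α_0, Q^{1/2} (Q^{k/2} α_0)⁻¹, Q^{1/2}, Q^N)`, and it sends `(τ_0, τ_1, τ_2)` to
`(τ_N^{k-2}, τ_N^k, τ_N^{k-1})` and the `\overline{τ}_i` to the same with `N + 1` for `N`. -/
def site (h : ℂ) (τ : ℤ → ℤ → ℂ → ℂ) (k N : ℤ) (α₀ : ℂ) : TauPoint where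
  α := ![h ^ k * α₀, h * (h ^ k * α₀)⁻¹, h]
  γ := (h ^ 2) ^ N
  τ := ![τ (k - 2) N α₀, τ k N α₀, τ (k - 1) N α₀]
  τb := ![τ (k - 2) (N + 1) α₀, τ k (N + 1) α₀, τ (k - 1) (N + 1) α₀]

/-- `τ` functions of `q`-P_II on a set `D` of parameters `α₀`, under `α_2 = Q^{1/2}`, `γ = 1` and
`τ_N^k = 0` for `N < 0`: they are consistent with the action of the group generated by `R_1` and
`T_4`. -/
structure IsHypergeometricTau (h : ℂ) (D : Set ℂ) (τ : ℤ → ℤ → ℂ → ℂ) : Prop where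
  shift : ∀ k N : ℤ, ∀ α₀ ∈ D, τ k N α₀ = τ 0 N (h ^ k * α₀)
  r1 : ∀ k N : ℤ, ∀ α₀ ∈ D, R1Rel (h ^ 2) (site h τ k N α₀) (site h τ (k + 1) N α₀)
  r1_inv : ∀ k N : ℤ, ∀ α₀ ∈ D, R1InvRel (h ^ 2) (site h τ k N α₀) (site h τ (k - 1) N α₀)
  t4 : ∀ k N : ℤ, ∀ α₀ ∈ D, T4Rel (h ^ 2) (site h τ k N α₀) (site h τ k (N + 1) α₀)
  t4_inv : ∀ k N : ℤ, ∀ α₀ ∈ D, T4InvRel (h ^ 2) (site h τ k N α₀) (site h τ k (N - 1) α₀)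
  boundary : ∀ k N : ℤ, N < 0 → ∀ α₀ ∈ D, τ k N α₀ = 0

/-- A function of `α₀` with `A(Q^{1/2} α₀) = A(α₀)`, i.e. for which `A_k = A(Q^{k/2} α₀)` satisfies
`A_{k+1} = A_k`. -/
def IsPeriodic (h : ℂ) (A : ℂ → ℂ) : Prop := ∀ α₀, A (h * α₀) = A α₀

/-- The entries `G_k`, with `A_k = A(Q^{k/2} α₀)`, `B_k = B(Q^{k/2} α₀)`, `a_0 = α₀^6`. -/
def entryG (h : ℂ) (A B : ℂ → ℂ) (k : ℤ) (α₀ : ℂ) : ℂ :=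
  A (h ^ k * α₀) * Theta (I * α₀ ^ 6 * (h ^ 3) ^ (2 * k + 1)) (h ^ 6)
      * onePhiOne 0 (-h ^ 6) (h ^ 6) (-I * α₀ ^ 6 * (h ^ 3) ^ (3 + 2 * k))
    + B (h ^ k * α₀) * Theta (-I * α₀ ^ 6 * (h ^ 3) ^ (2 * k + 1)) (h ^ 6)
      * onePhiOne 0 (-h ^ 6) (h ^ 6) (I * α₀ ^ 6 * (h ^ 3) ^ (3 + 2 * k))

/-- The determinant `φ_N^k = det (G_{k+2i-j-1})_{1 ≤ i, j ≤ N}`, with `φ_0^k = 1` and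
`φ_N^k = 0` for `N < 0`. -/
def phiDet (G : ℤ → ℂ) (k N : ℤ) : ℂ :=
  if N < 0 then 0
  else Matrix.det (Matrix.of fun i j : Fin N.toNat =>
    G (k + 2 * ((i : ℤ) + 1) - ((j : ℤ) + 1) - 1))

/-- The product of three elliptic gamma functions. -/
def gammaFactor (h : ℂ) (k : ℤ) (α₀ : ℂ) : ℂ :=
  ellGamma (h ^ (2 * k + 3) * α₀ ^ 2) (h ^ 2) (h ^ 2)
    * ellGamma (h ^ (-k) * α₀⁻¹) (h ^ 2) (h ^ 2)
    * ellGamma (h ^ (-k + 3) * α₀⁻¹) (h ^ 2) (h ^ 2)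

/-- The explicit `τ` functions. -/
def hyperTau (h : ℂ) (A B : ℂ → ℂ) (k N : ℤ) (α₀ : ℂ) : ℂ :=
  (-1) ^ (N * (N - 1) / 2) * (h ^ 2) ^ (N * (N - 1) * (k + N)) * α₀ ^ (2 * N * (N - 1))
    * (gammaFactor h k α₀ / Theta ((h ^ 2) ^ (3 * k + 1) * α₀ ^ 6) ((h ^ 2) ^ 3) ^ N)
    * phiDet (fun l => entryG h A B l α₀) k N

/-- The parameters at which, for every `k`, the three gamma factors of `τ_N^k` and the theta function
`Θ(Q^{3k+1} α₀^6; Q^3)` have neither a zero nor a pole. -/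
def IsGeneric (h α₀ : ℂ) : Prop :=
  α₀ ≠ 0 ∧ ∀ j : ℤ, α₀ ≠ h ^ j ∧ α₀ ^ 2 ≠ h ^ (2 * j + 1) ∧ α₀ ^ 6 ≠ h ^ (6 * j - 2)

/-- The parameters at which both theta functions `Θ(± i a_0 q^{1/4}; q^{1/2})` are non-zero. -/
def ThetaNonzero (h α₀ : ℂ) : Prop :=
  Theta (I * α₀ ^ 6 * h ^ 3) (h ^ 6) ≠ 0 ∧ Theta (-I * α₀ ^ 6 * h ^ 3) (h ^ 6) ≠ 0

/-- The three-term relation `G_{k+1} - G_k + a_0^{-2} q^{-k} G_{k-1} = 0` with `a_0 = α₀^6`,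
`q = h^{12}`. -/
def ThreeTerm (h α₀ : ℂ) (G : ℤ → ℂ) : Prop :=
  ∀ k : ℤ, G (k + 1) - G k + (α₀ ^ 6) ^ (-2 : ℤ) * (h ^ 12) ^ (-k) * G (k - 1) = 0

end QPainleve

end

/-! Everything at the site $(k,N)$ depends on $k$ through $x=Q^{k/2}\alpha_0$: the coefficient
$a_0^{-2}q^{-k}$ is $x^{-12}$, and the prefactor of $\phi_N^k$ is a function of $x$ and $N$.

General solution. With $p=q^{1/2}$, the function $\Theta(z;p)\,{}_1\varphi_1(0;-p;p,-pz)$ satisfies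
a second order $p$-difference equation whose coefficients are even in $z$. Hence $z$ and $-z$ give
two solutions, and along $z_k=ia_0q^{(2k+1)/4}$ the equation is the three-term relation. The
Casoratian of the two ${}_1\varphi_1$ factors is the constant $2$ (`onePhiOne_casorati`), so the
solutions are independent as soon as $\Theta(\pm z_0;p)\ne0$.

Explicit $\tau$ functions. With denominators cleared, $R_1^{\pm1}$ amounts to two bilinear equations
and $T_4^{\pm1}$ to three trilinear ones each. For determinants they follow from four bilinear
identities, `casDet_jacobi`, `casDet_bilinear_down`, `casDet_bilinear_up` and `casDet_toda`. Each is
a Plücker relation `detTwo_plucker` among consecutive rows, unit vectors (which delete columns) and,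
for the last three, one weighted row produced by the three-term relation (`casDet_eq_casKappa_mul`
and its variant). In `phiDet_trilinear` and `phiDet_trilinear_inv` two bilinear identities are
combined to eliminate the site outside $\{k-2,k-1,k\}$. Quasi-periodicity of $\Theta$ and the
difference equation of $\Gamma$ take care of the prefactors.

Converse. At $N=0$ the condition $\tau_{-1}^k=0$ makes $T_4^{-1}$ linear in $\tau_1$, and this is
the three-term relation for the normalized $\tau_1^k$ (`threeTerm_tauEntry`). So $\tau_1$ is given
by some $A,B$, and $T_4$ determines $\tau_{N+2}$ from $\tau_N$ and $\tau_{N+1}$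
(`eq_hyperTau_of_eq_zero_one`). -/

noncomputable section

namespace QPainleve

/-! ### Plücker relations and determinants with unit rows. -/

section Determinants

open Matrix

variable {K : Type*} [Field K]

/-- The determinant with rows `a`, `b` followed by the rows of `A`. -/
def detTwo {n : ℕ} (a b : Fin (n + 2) → K) (A : Fin n → Fin (n + 2) → K) : K :=
  Matrix.det (Matrix.of (Matrix.vecCons a (Matrix.vecCons b A)))

theorem exists_detTwo_eq_sum {n : ℕ} (d : Fin (n + 2) → K) (A : Fin n → Fin (n + 2) → K) :
    ∃ w : Fin (n + 2) → K, ∀ x, detTwo x d A = ∑ j, x j * w j := by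
  refine ⟨fun j => (-1) ^ (j : ℕ) *
    Matrix.det ((Matrix.of (Matrix.vecCons d A)).submatrix id j.succAbove), fun x => ?_⟩
  rw [detTwo, Matrix.det_succ_row_zero]
  refine Finset.sum_congr rfl fun j _ => ?_
  have : (Matrix.of (Matrix.vecCons x (Matrix.vecCons d A))).submatrix Fin.succ j.succAbove
      = (Matrix.of (Matrix.vecCons d A)).submatrix id j.succAbove := by
    ext i l; simp
  rw [this]
  simp
  ring

theorem detTwo_swap {n : ℕ} (a b : Fin (n + 2) → K) (A : Fin n → Fin (n + 2) → K) :
    detTwo a b A = - detTwo b a A := by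
  have h := Matrix.det_permute (Equiv.swap (0 : Fin (n + 2)) 1)
      (Matrix.of (Matrix.vecCons b (Matrix.vecCons a A)))
  rw [Equiv.Perm.sign_swap (by simp)] at h
  simp only [Units.val_neg, Units.val_one, Int.cast_neg, Int.cast_one, neg_mul, one_mul] at h
  unfold detTwo
  rw [← h]
  congr 1; ext i l
  refine Fin.cases ?_ (fun i => ?_) i
  · simp
  · refine Fin.cases ?_ (fun i => ?_) i
    · simp
    · have h0 : i.succ.succ ≠ (0 : Fin (n + 2)) := by simp [Fin.ext_iff]
      have h1 : i.succ.succ ≠ (1 : Fin (n + 2)) := by simp [Fin.ext_iff]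
      simp [Equiv.swap_apply_of_ne_of_ne h0 h1]

/-- Cramer's rule writes $\det M\cdot c$ as a combination of the rows of $M=(a,b,A)$, with
coefficients the determinants in which $c$ replaces a row. Applying the linear form $x\mapsto$
`detTwo x d A` kills all rows of $A$, so only the terms of $a$ and $b$ survive. -/
theorem detTwo_plucker {n : ℕ} (a b c d : Fin (n + 2) → K) (A : Fin n → Fin (n + 2) → K) :
    detTwo a b A * detTwo c d A - detTwo a c A * detTwo b d A
      + detTwo a d A * detTwo b c A = 0 := by
  set M : Matrix (Fin (n + 2)) (Fin (n + 2)) K :=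
    Matrix.of (Matrix.vecCons a (Matrix.vecCons b A)) with hM
  obtain ⟨w, hw⟩ := exists_detTwo_eq_sum d A
  have h1 := Matrix.mulVec_cramer Mᵀ c
  have h2 : M.det * detTwo c d A
      = ∑ i, (M.updateRow i c).det * detTwo (M i) d A := by
    rw [hw c, Finset.mul_sum]
    have : ∀ j, M.det * (c j * w j) = ∑ i, (M.updateRow i c).det * (M i j * w j) := by
      intro j
      have h3 := congrFun h1 j
      simp only [Matrix.mulVec, dotProduct, Matrix.transpose_apply, Matrix.det_transpose,
        Pi.smul_apply, smul_eq_mul, Matrix.cramer_transpose_apply] at h3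
      rw [← mul_assoc, ← h3, Finset.sum_mul]
      exact Finset.sum_congr rfl fun i _ => by ring
    rw [Finset.sum_congr rfl fun j _ => this j, Finset.sum_comm]
    refine Finset.sum_congr rfl fun i _ => ?_
    rw [hw (M i), Finset.mul_sum]
  have h4 : ∀ i : Fin n, detTwo (M i.succ.succ) d A = 0 := by
    intro i
    unfold detTwo
    refine Matrix.det_zero_of_row_eq (i := 0) (j := i.succ.succ) (by simp [Fin.ext_iff]) ?_
    ext l; simp [hM]
  have h5 : (M.updateRow 0 c).det = detTwo c b A := by
    unfold detTwo; congr 1; ext i l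
    refine Fin.cases ?_ (fun i => ?_) i <;> simp [hM]
  have h6 : (M.updateRow 1 c).det = detTwo a c A := by
    unfold detTwo; congr 1; ext i l
    refine Fin.cases ?_ (fun i => ?_) i
    · simp [hM]
    · refine Fin.cases ?_ (fun i => ?_) i
      · simp [hM]
      · have : i.succ.succ ≠ (1 : Fin (n + 2)) := by simp [Fin.ext_iff]
        rw [Matrix.updateRow_ne this]; simp [hM]
  have h7 := detTwo_swap c b A
  rw [Fin.sum_univ_succ, Fin.sum_univ_succ] at h2
  simp only [h4, mul_zero, Finset.sum_const_zero, add_zero] at h2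
  have e0 : M 0 = a := by ext; simp [hM]
  have e1 : M (Fin.succ 0) = b := by ext; simp [hM]
  have e2 : (Fin.succ 0 : Fin (n + 2)) = 1 := rfl
  rw [e0, e1, h5, e2, h6, h7] at h2
  have e3 : M.det = detTwo a b A := rfl
  rw [e3] at h2
  linear_combination h2

theorem det_cons_eq_det_snoc {n : ℕ} (e : Fin (n + 1) → K) (A : Fin n → Fin (n + 1) → K) :
    Matrix.det (Matrix.of (Matrix.vecCons e A))
      = (-1) ^ n * Matrix.det (Matrix.of (Fin.snoc A e : Fin (n + 1) → Fin (n + 1) → K)) := by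
  have := Matrix.det_permute (finRotate (n + 1)) (Matrix.of (Matrix.vecCons e A))
  rw [sign_finRotate] at this
  have h2 : (Matrix.of (Fin.snoc A e : Fin (n + 1) → Fin (n + 1) → K))
      = (Matrix.of (Matrix.vecCons e A)).submatrix (finRotate (n + 1)) id := by
    ext i l
    have := Fin.snoc_eq_cons_rotate A e
    rw [this]; rfl
  rw [h2, this]
  push_cast
  rw [← mul_assoc, ← mul_pow]; simp

/-- Needed when the second vector continues a block of consecutive rows at its lower end rather than
at its upper end. -/
theorem detTwo_eq_snoc {n : ℕ} (a e : Fin (n + 2) → K) (A : Fin n → Fin (n + 2) → K) :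
    detTwo a e A
      = (-1) ^ n * Matrix.det (Matrix.of (Matrix.vecCons a
          (Fin.snoc A e : Fin (n + 1) → Fin (n + 2) → K))) := by
  rw [detTwo, Matrix.det_succ_row_zero, Matrix.det_succ_row_zero, Finset.mul_sum]
  refine Finset.sum_congr rfl fun j _ => ?_
  have e1 : (Matrix.of (Matrix.vecCons a (Matrix.vecCons e A))).submatrix Fin.succ j.succAbove
      = Matrix.of (Matrix.vecCons (fun l => e (j.succAbove l))
        (fun i l => A i (j.succAbove l))) := by
    ext i l; refine Fin.cases ?_ (fun i => ?_) i <;> simp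
  have e2 : (Matrix.of (Matrix.vecCons a
          (Fin.snoc A e : Fin (n + 1) → Fin (n + 2) → K))).submatrix Fin.succ j.succAbove
      = Matrix.of (Fin.snoc (fun i l => A i (j.succAbove l))
        (fun l => e (j.succAbove l)) : Fin (n + 1) → Fin (n + 1) → K) := by
    ext i l; refine Fin.lastCases ?_ (fun i => ?_) i
    · simp only [Matrix.submatrix_apply, Matrix.of_apply, Matrix.cons_val_succ]; simp
    · simp
  rw [e1, e2, det_cons_eq_det_snoc]
  simp
  ring

theorem det_cons_single_zero {n : ℕ} (A : Fin n → Fin (n + 1) → K) :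
    Matrix.det (Matrix.of (Matrix.vecCons (Pi.single 0 1) A))
      = Matrix.det (Matrix.of fun i j => A i (Fin.succ j)) := by
  rw [Matrix.det_succ_row_zero, Finset.sum_eq_single 0]
  · simp; congr 1
  · intro j _ hj; simp [hj]
  · simp

theorem det_cons_single_last {n : ℕ} (A : Fin n → Fin (n + 1) → K) :
    Matrix.det (Matrix.of (Matrix.vecCons (Pi.single (Fin.last n) 1) A))
      = (-1) ^ n * Matrix.det (Matrix.of fun i j => A i (Fin.castSucc j)) := by
  rw [Matrix.det_succ_row_zero, Finset.sum_eq_single (Fin.last n)]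
  · simp; congr 1
  · intro j _ hj; simp [hj]
  · simp

end Determinants

/-! ### Casorati determinants with step two, without any recurrence. -/

section Casorati

variable {K : Type*} [Field K]

/-- The vector `(G_m, G_{m+2}, …)`. -/
def casVec (G : ℤ → K) (p : ℕ) (m : ℤ) : Fin p → K := fun i => G (m + 2 * (i : ℤ))

/-- The vectors `casVec G p (m - j)` for `j < n`. -/
def casBlk (G : ℤ → K) (p : ℕ) (m : ℤ) (n : ℕ) : Fin n → Fin p → K :=
  fun j => casVec G p (m - (j : ℤ))

/-- The determinant `φ_n^k` for `n ≥ 0`. -/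
def casDet (G : ℤ → K) (n : ℕ) (k : ℤ) : K := Matrix.det (Matrix.of (casBlk G n k n))

theorem casBlk_succ_cons (G : ℤ → K) (p : ℕ) (m : ℤ) (n : ℕ) :
    casBlk G p m (n + 1) = Matrix.vecCons (casVec G p m) (casBlk G p (m - 1) n) := by
  ext i l
  refine Fin.cases ?_ (fun i => ?_) i
  · simp [casBlk]
  · simp only [casBlk, Matrix.cons_val_succ, Fin.val_succ]
    congr 1; push_cast; ring

theorem casBlk_succ_snoc (G : ℤ → K) (p : ℕ) (m : ℤ) (n : ℕ) :
    casBlk G p m (n + 1)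
      = (Fin.snoc (casBlk G p m n) (casVec G p (m - n)) : Fin (n + 1) → Fin p → K) := by
  ext i l
  refine Fin.lastCases ?_ (fun i => ?_) i
  · simp [casBlk]
  · simp [casBlk]

theorem detTwo_casVec_left (G : ℤ → K) (n : ℕ) (m : ℤ) (a : Fin (n + 2) → K) :
    detTwo a (casVec G (n + 2) m) (casBlk G (n + 2) (m - 1) n)
      = Matrix.det (Matrix.of (Matrix.vecCons a (casBlk G (n + 2) m (n + 1)))) := by
  rw [casBlk_succ_cons]; rfl

theorem detTwo_casVec_right (G : ℤ → K) (n : ℕ) (m : ℤ) (a : Fin (n + 2) → K) :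
    detTwo a (casVec G (n + 2) (m - n)) (casBlk G (n + 2) m n)
      = (-1) ^ n * Matrix.det (Matrix.of (Matrix.vecCons a (casBlk G (n + 2) m (n + 1)))) := by
  rw [detTwo_eq_snoc, casBlk_succ_snoc]

theorem det_cons_casVec (G : ℤ → K) (n : ℕ) (m : ℤ) :
    Matrix.det (Matrix.of (Matrix.vecCons (casVec G (n + 1) m) (casBlk G (n + 1) (m - 1) n)))
      = casDet G (n + 1) m := by
  rw [casDet, casBlk_succ_cons]

/-- Deleting the first column raises all indices by two, whereas deleting the last column leaves
them unchanged. This is how unit vectors produce shifted determinants of smaller size. -/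
theorem det_cons_single_zero_casBlk (G : ℤ → K) (n : ℕ) (m : ℤ) :
    Matrix.det (Matrix.of (Matrix.vecCons (Pi.single 0 1) (casBlk G (n + 1) m n)))
      = casDet G n (m + 2) := by
  rw [det_cons_single_zero, casDet]
  congr 1; ext i j
  simp only [casBlk, casVec, Matrix.of_apply, Fin.val_succ]
  congr 1; push_cast; ring

theorem det_cons_single_last_casBlk (G : ℤ → K) (n : ℕ) (m : ℤ) :
    Matrix.det (Matrix.of (Matrix.vecCons (Pi.single (Fin.last n) 1) (casBlk G (n + 1) m n)))
      = (-1) ^ n * casDet G n m := by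
  rw [det_cons_single_last, casDet]
  congr 1

theorem detTwo_single_zero_last_casBlk (G : ℤ → K) (n : ℕ) (m : ℤ) :
    detTwo (Pi.single 0 1) (Pi.single (Fin.last (n + 1)) 1) (casBlk G (n + 2) m n)
      = (-1) ^ n * casDet G n (m + 2) := by
  have : (fun (i : Fin (n + 1)) (j : Fin (n + 1)) =>
      Matrix.vecCons (Pi.single (Fin.last (n + 1)) 1) (casBlk G (n + 2) m n) i (Fin.succ j))
      = Matrix.vecCons (Pi.single (Fin.last n) 1) (casBlk G (n + 1) (m + 2) n) := by
    ext i j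
    refine Fin.cases ?_ (fun i => ?_) i
    · simp [← Fin.succ_last, Pi.single_apply]
    · simp only [casBlk, casVec, Matrix.cons_val_succ, Fin.val_succ]
      congr 1; push_cast; ring
  rw [detTwo, det_cons_single_zero, this, det_cons_single_last_casBlk]

/-- Bilinear identity of Desnanot–Jacobi type. -/
theorem casDet_jacobi (G : ℤ → K) (n : ℕ) (k : ℤ) :
    casDet G (n + 2) k * casDet G n (k + 1)
      = casDet G (n + 1) k * casDet G (n + 1) (k + 1)
        - casDet G (n + 1) (k + 2) * casDet G (n + 1) (k - 1) := by
  -- The vectors with indices $k$ and $k-1-n$ are the two ends of a run of $n+2$ consecutive rows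
  -- whose interior is the block, and the unit vectors delete the first and the last column.
  have h := detTwo_plucker (casVec G (n + 2) k) (casVec G (n + 2) (k - 1 - n))
    (Pi.single 0 1) (Pi.single (Fin.last (n + 1)) 1) (casBlk G (n + 2) (k - 1) n)
  have e1 := detTwo_casVec_right G n (k - 1) (casVec G (n + 2) k)
  have e1' := det_cons_casVec G (n + 1) k
  have e2 := detTwo_single_zero_last_casBlk G n (k - 1)
  have e3 := detTwo_casVec_left G n k (Pi.single 0 1)
  have e3' := det_cons_single_zero_casBlk G (n + 1) k
  have e4 := detTwo_casVec_right G n (k - 1) (Pi.single (Fin.last (n + 1)) 1)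
  have e4' := det_cons_single_last_casBlk G (n + 1) (k - 1)
  have e5 := detTwo_casVec_left G n k (Pi.single (Fin.last (n + 1)) 1)
  have e5' := det_cons_single_last_casBlk G (n + 1) k
  have e6 := detTwo_casVec_right G n (k - 1) (Pi.single 0 1)
  have e6' := det_cons_single_zero_casBlk G (n + 1) (k - 1)
  rw [detTwo_swap (casVec G (n + 2) k) (Pi.single 0 1),
    detTwo_swap (casVec G (n + 2) (k - 1 - n)) (Pi.single 0 1),
    detTwo_swap (casVec G (n + 2) k) (Pi.single (Fin.last (n + 1)) 1),
    detTwo_swap (casVec G (n + 2) (k - 1 - n)) (Pi.single (Fin.last (n + 1)) 1),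
    e1, e1', e2, e3, e3', e4, e4', e5, e5', e6, e6'] at h
  rw [show k - 1 + 2 = k + 1 by ring] at h
  have s : ((-1 : K) ^ n) * (-1) ^ n = 1 := by rw [← mul_pow]; simp
  have s' : ((-1 : K) ^ (n + 1)) = -(-1) ^ n := by ring
  rw [s'] at h
  generalize (-1 : K) ^ n = s at *
  linear_combination h - (casDet G (n + 2) k * casDet G n (k + 1)
      - casDet G (n + 1) k * casDet G (n + 1) (k + 1)
        + casDet G (n + 1) (k + 2) * casDet G (n + 1) (k - 1)) * s
end Casorati

/-! ### Determinants whose entries satisfy the three-term relation. -/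

section ThreeTermDet

variable {K : Type*} [Field K]

/-- The vector `(G_m, q^2 G_{m+2}, q^4 G_{m+4}, …)`. -/
def casVecE (q : K) (G : ℤ → K) (p : ℕ) (m : ℤ) : Fin p → K :=
  fun i => q ^ (2 * (i : ℕ)) * G (m + 2 * (i : ℤ))

/-- The factor relating `φ_{n+1}^k` to the determinant with one row `casVecE`. -/
def casKappa (q : K) (c : ℤ → K) (n : ℕ) (k : ℤ) : K :=
  c k ^ n * ∏ i ∈ Finset.range n, (q ^ (i + 1))⁻¹

variable {q : K} {c : ℤ → K} {G : ℤ → K}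

theorem shift_nat_of_geometric (hc : ∀ k, c k = q * c (k + 1)) (k : ℤ) (n : ℕ) :
    c k = q ^ n * c (k + n) := by
  induction n with
  | zero => simp
  | succ n ih => rw [ih, hc (k + n)]; push_cast; rw [add_assoc]; ring

theorem casKappa_succ (hq : q ≠ 0) (n : ℕ) (k : ℤ) :
    casKappa q c (n + 1) k * q ^ (n + 1) = casKappa q c n k * c k := by
  rw [casKappa, casKappa, Finset.prod_range_succ, pow_succ]
  field_simp

theorem casKappa_shift (hc : ∀ k, c k = q * c (k + 1)) (n : ℕ) (k : ℤ) :
    casKappa q c n k = q ^ n * casKappa q c n (k + 1) := by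
  rw [casKappa, casKappa, hc k, mul_pow]; ring

/-- The row factors are $c_{k-1-j}=q^{j+1}c_k$, and the column weights contribute $q^{-2i}$. For
each $j$ the two powers combine to $q^{-(j+1)}$. -/
theorem casKappa_eq_prod (hq : q ≠ 0) (hc : ∀ k, c k = q * c (k + 1)) (n : ℕ) (k : ℤ) :
    (∏ j : Fin n, c (k - 1 - (j : ℤ))) * ∏ i : Fin (n + 1), (q ^ (2 * (i : ℕ)))⁻¹
      = casKappa q c n k := by
  induction n with
  | zero => simp [casKappa]
  | succ n ih =>
    have h1 := shift_nat_of_geometric hc (k - 1 - n) (n + 1)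
    rw [show k - 1 - (n : ℤ) + ((n + 1 : ℕ) : ℤ) = k by push_cast; ring] at h1
    rw [Fin.prod_univ_castSucc, Fin.prod_univ_castSucc (n := n + 1)]
    simp only [Fin.val_castSucc, Fin.val_last]
    have h2 := casKappa_succ (c := c) hq n k
    rw [← ih] at h2
    have h3 : q ^ (n + 1) ≠ 0 := pow_ne_zero _ hq
    rw [← mul_left_inj' h3, h2, h1]
    have h4 : q ^ (2 * (n + 1)) = q ^ (n + 1) * q ^ (n + 1) := by ring
    rw [h4]
    field_simp

/-- The determinant `φ_{n+1}^k` after differencing its columns by the three-term relation. -/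
theorem casDet_eq_casKappa_mul (hq : q ≠ 0) (hc : ∀ k, c k = q * c (k + 1))
    (hG : ∀ k, G (k + 1) - G k + c k * G (k - 1) = 0) (n : ℕ) (k : ℤ) :
    casDet G (n + 1) k = casKappa q c n k
      * Matrix.det (Matrix.of (Matrix.vecCons (casVecE q G (n + 1) k)
          (casBlk G (n + 1) (k - 2) n))) := by
  set M : Matrix (Fin (n + 1)) (Fin (n + 1)) K :=
    Matrix.of (Matrix.vecCons (casVecE q G (n + 1) k) (casBlk G (n + 1) (k - 2) n)) with hM
  have h1 := Matrix.det_mul_row (fun i : Fin (n + 1) => (q ^ (2 * (i : ℕ)))⁻¹) M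
  have h2 := Matrix.det_mul_column
    (Matrix.vecCons 1 (fun j : Fin n => c (k - 1 - (j : ℤ))) : Fin (n + 1) → K)
    (Matrix.of fun i j : Fin (n + 1) => (q ^ (2 * (j : ℕ)))⁻¹ * M i j)
  rw [h1, Fin.prod_univ_succ] at h2
  simp only [Matrix.cons_val_zero, Matrix.cons_val_succ, one_mul] at h2
  rw [← mul_assoc, casKappa_eq_prod hq hc] at h2
  rw [← h2, casDet]
  -- Subtract from each row its predecessor. Since $c_{m+2j}=q^{-2j}c_m$, the difference is a row
  -- with index lower by one than the row being replaced, times a scalar, with the weight $q^{-2j}$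
  -- in column $j$. The first row is not differenced and so keeps the inverse weight, which is
  -- `casVecE`.
  refine Matrix.det_eq_of_forall_row_eq_smul_add_pred (fun _ => 1) (fun j => ?_) (fun i j => ?_)
  · have : q ^ (2 * (j : ℕ)) ≠ 0 := pow_ne_zero _ hq
    simp [hM, casBlk, casVec, casVecE, this]
  · have h3 := shift_nat_of_geometric hc (k - 1 - i) (2 * j)
    have h4 := hG (k - 1 - i + 2 * j)
    push_cast at h3
    have h5 : q ^ (2 * (j : ℕ)) ≠ 0 := pow_ne_zero _ hq
    simp only [hM, casBlk, casVec, Matrix.of_apply, Matrix.cons_val_succ, Fin.val_succ,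
      Fin.val_castSucc]
    rw [h3]
    have e1 : k - 1 - (i : ℤ) + 2 * j + 1 = k - i + 2 * j := by ring
    have e2 : k - 1 - (i : ℤ) + 2 * j - 1 = k - 2 - i + 2 * j := by ring
    have e3 : k - 1 - (i : ℤ) + 2 * j = k - ((i + 1 : ℕ) : ℤ) + 2 * j := by push_cast; ring
    rw [e1, e2] at h4
    rw [e3] at h4 ⊢
    field_simp
    linear_combination -h4

/-- Adding $c_{k-1}$ times the second row to the weighted row lowers the index of the latter from
$k$ to $k-1$, by the three-term relation. One weighted row can thus represent two neighbouring
determinants, depending on where the block below it starts. -/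
theorem casDet_eq_casKappa_mul' (hq : q ≠ 0) (hc : ∀ k, c k = q * c (k + 1))
    (hG : ∀ k, G (k + 1) - G k + c k * G (k - 1) = 0) (n : ℕ) (k : ℤ) :
    casDet G (n + 2) k = casKappa q c (n + 1) k
      * Matrix.det (Matrix.of (Matrix.vecCons (casVecE q G (n + 2) (k - 1))
          (casBlk G (n + 2) (k - 2) (n + 1)))) := by
  rw [casDet_eq_casKappa_mul hq hc hG]
  congr 1
  rw [← Matrix.det_updateRow_add_smul_self (Matrix.of (Matrix.vecCons (casVecE q G (n + 2) k)
          (casBlk G (n + 2) (k - 2) (n + 1)))) (i := 0) (j := 1) (by simp) (c (k - 1))]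
  congr 1
  ext i j
  refine Fin.cases ?_ (fun i => ?_) i
  · have h3 := shift_nat_of_geometric hc (k - 1) (2 * j)
    have h4 := hG (k - 1 + 2 * j)
    push_cast at h3
    rw [show k - 1 + 2 * (j : ℤ) + 1 = k + 2 * j by ring,
      show k - 1 + 2 * (j : ℤ) - 1 = k - 2 + 2 * j by ring] at h4
    simp only [Matrix.updateRow_self, Pi.add_apply, Pi.smul_apply, Matrix.of_apply,
      Matrix.cons_val_zero, Matrix.cons_val_one, casBlk, casVec, casVecE, smul_eq_mul, h3]
    simp only [Fin.val_zero, Nat.cast_zero, sub_zero]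
    linear_combination q ^ (2 * (j : ℕ)) * h4
  · simp

theorem det_cons_single_zero_casVecE (n : ℕ) (m l : ℤ) :
    detTwo (Pi.single 0 1) (casVecE q G (n + 2) m) (casBlk G (n + 2) l n)
      = q ^ 2 * Matrix.det (Matrix.of (Matrix.vecCons (casVecE q G (n + 1) (m + 2))
          (casBlk G (n + 1) (l + 2) n))) := by
  rw [detTwo, det_cons_single_zero]
  have h := Matrix.det_updateRow_smul (Matrix.of (Matrix.vecCons (casVecE q G (n + 1) (m + 2))
          (casBlk G (n + 1) (l + 2) n))) 0 (q ^ 2) (casVecE q G (n + 1) (m + 2))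
  have e : (Matrix.of (Matrix.vecCons (casVecE q G (n + 1) (m + 2))
      (casBlk G (n + 1) (l + 2) n))).updateRow 0 (casVecE q G (n + 1) (m + 2))
      = Matrix.of (Matrix.vecCons (casVecE q G (n + 1) (m + 2)) (casBlk G (n + 1) (l + 2) n)) :=
    Matrix.updateRow_eq_self _ 0
  rw [e] at h
  rw [← h]
  congr 1
  ext i j
  refine Fin.cases ?_ (fun i => ?_) i
  · simp only [Matrix.of_apply, Matrix.cons_val_zero, Matrix.updateRow_self, casVecE,
      Pi.smul_apply, smul_eq_mul, Fin.val_succ]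
    rw [show m + 2 + 2 * ((j : ℕ) : ℤ) = m + 2 * (((j : ℕ) + 1 : ℕ) : ℤ) by push_cast; ring]
    ring
  · simp only [Matrix.of_apply, Matrix.cons_val_succ, casBlk, casVec, Fin.val_succ,
      Matrix.updateRow_ne (Fin.succ_ne_zero i)]
    congr 1; push_cast; ring

theorem det_cons_single_last_casVecE (n : ℕ) (m l : ℤ) :
    detTwo (Pi.single (Fin.last (n + 1)) 1) (casVecE q G (n + 2) m) (casBlk G (n + 2) l n)
      = (-1) ^ (n + 1) * Matrix.det (Matrix.of (Matrix.vecCons (casVecE q G (n + 1) m)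
          (casBlk G (n + 1) l n))) := by
  rw [detTwo, det_cons_single_last]
  congr 2
  ext i j
  refine Fin.cases ?_ (fun i => ?_) i
  · simp [casVecE]
  · simp [casBlk, casVec]

end ThreeTermDet

/-! ### The three bilinear identities that use the recurrence. -/

section Bilinear

variable {K : Type*} [Field K] {q : K} {c : ℤ → K} {G : ℤ → K}

theorem casDet_zero (G : ℤ → K) (k : ℤ) : casDet G 0 k = 1 := by simp [casDet]

theorem casDet_one (G : ℤ → K) (k : ℤ) : casDet G 1 k = G k := by
  simp [casDet, casBlk, casVec]

theorem casDet_bilinear_down (hq : q ≠ 0) (hc : ∀ k, c k = q * c (k + 1))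
    (hG : ∀ k, G (k + 1) - G k + c k * G (k - 1) = 0) (n : ℕ) (k : ℤ) :
    q ^ n * (casDet G (n + 1) k * casDet G n (k - 1)) - casDet G n k * casDet G (n + 1) (k - 1)
      + q ^ n * c (k - 1) * (casDet G (n + 1) (k - 2) * casDet G n (k + 1)) = 0 := by
  -- For $n=0$ the matrices are too small for a Plücker relation, and the claim is the three-term
  -- relation itself.
  rcases n with _ | n
  · simp only [casDet_zero, zero_add, casDet_one]
    have := hG (k - 1)
    rw [show k - 1 + 1 = k by ring, show k - 1 - 1 = k - 2 by ring] at this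
    linear_combination this
  set b := casVec G (n + 2) (k - 3 - n) with hb
  set d := casVecE q G (n + 2) (k - 1) with hd
  set A := casBlk G (n + 2) (k - 3) n with hA
  -- The weighted row of index $k-1$ yields $\phi^k$ above a block starting at $k-2$ and
  -- $\phi^{k-1}$ above one starting at $k-3$. Together with the first unit vector it yields
  -- $\phi^{k+1}$, one size smaller.
  have h := detTwo_plucker (casVec G (n + 2) (k - 2)) b (Pi.single 0 1) d A
  have e1 := detTwo_casVec_right G n (k - 3) (casVec G (n + 2) (k - 2))
  have e1' := det_cons_casVec G (n + 1) (k - 2)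
  have e2 := det_cons_single_zero_casVecE (q := q) (G := G) n (k - 1) (k - 3)
  have e2' := casDet_eq_casKappa_mul hq hc hG n (k + 1)
  have e3 := detTwo_casVec_left G n (k - 2) (Pi.single 0 1)
  have e3' := det_cons_single_zero_casBlk G (n + 1) (k - 2)
  have e4 := detTwo_casVec_right G n (k - 3) d
  have e4' := casDet_eq_casKappa_mul hq hc hG (n + 1) (k - 1)
  have e5 := detTwo_casVec_left G n (k - 2) d
  have e5' := casDet_eq_casKappa_mul' hq hc hG n k
  have e6 := detTwo_casVec_right G n (k - 3) (Pi.single 0 1)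
  have e6' := det_cons_single_zero_casBlk G (n + 1) (k - 3)
  rw [show k - 2 - 1 = k - 3 by ring] at e1' e3 e5
  rw [show k - 1 - 2 = k - 3 by ring] at e4'
  rw [show k - 1 + 2 = k + 1 by ring, show k - 3 + 2 = k - 1 by ring] at e2
  rw [show k + 1 - 2 = k - 1 by ring] at e2'
  rw [show k - 2 + 2 = k by ring] at e3'
  rw [show k - 3 + 2 = k - 1 by ring] at e6'
  rw [← hA, ← hb] at e1 e4 e6
  rw [← hA, ← hd] at e2
  rw [← hA] at e3 e5
  rw [e1'] at e1
  rw [e3'] at e3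
  rw [← hd] at e4' e5'
  rw [e6'] at e6
  have k1 := casKappa_succ (c := c) hq n k
  have k2 := casKappa_shift hc n k
  have k3 := casKappa_shift hc (n + 1) (k - 1)
  rw [show k - 1 + 1 = k by ring] at k3
  have hck := hc (k - 1)
  rw [show k - 1 + 1 = k by ring] at hck
  have hqn : q ^ n ≠ 0 := pow_ne_zero _ hq
  have k4 : casKappa q c (n + 1) k * q = casKappa q c n (k + 1) * c k := by
    rw [k2] at k1
    apply mul_left_cancel₀ hqn
    linear_combination k1
  rw [detTwo_swap (casVec G (n + 2) (k - 2)) (Pi.single 0 1), detTwo_swap b d,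
    detTwo_swap (casVec G (n + 2) (k - 2)) d,
    detTwo_swap b (Pi.single 0 1), e1, e2, e3, e4, e5, e6] at h
  rw [e2', e4', e5', hck, k3]
  have hs : ((-1 : K) ^ n) ≠ 0 := pow_ne_zero _ (by simp)
  apply mul_left_cancel₀ hs
  set d2 := (Matrix.of (Matrix.vecCons (casVecE q G (n + 1) (k + 1))
    (casBlk G (n + 1) (k - 1) n))).det
  linear_combination q ^ (n + 1) * casKappa q c (n + 1) k * h
    - (-1) ^ n * q ^ (n + 2) * casDet G (n + 2) (k - 2) * d2 * k4

theorem casDet_bilinear_up (hq : q ≠ 0) (hc : ∀ k, c k = q * c (k + 1))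
    (hG : ∀ k, G (k + 1) - G k + c k * G (k - 1) = 0) (n : ℕ) (k : ℤ) :
    q ^ (2 * n) * (casDet G (n + 1) (k + 1) * casDet G n (k - 2))
      = q ^ n * (casDet G (n + 1) k * casDet G n (k - 1))
        - c k * (casDet G n k * casDet G (n + 1) (k - 1)) := by
  rcases n with _ | n
  · simp only [casDet_zero, zero_add, casDet_one]
    linear_combination hG k
  set b := casVec G (n + 2) (k - 2 - n) with hb
  set d := casVecE q G (n + 2) k with hd
  set A := casBlk G (n + 2) (k - 2) n with hA
  set e : Fin (n + 2) → K := Pi.single (Fin.last (n + 1)) 1 with he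
  -- The same mechanism with the weighted row of index $k$ and the last unit vector, so that the
  -- weighted row yields $\phi^{k+1}$, $\phi^k$ and a smaller $\phi^k$.
  have h := detTwo_plucker (casVec G (n + 2) (k - 1)) b d e A
  have e1 := detTwo_casVec_right G n (k - 2) (casVec G (n + 2) (k - 1))
  have e1' := det_cons_casVec G (n + 1) (k - 1)
  have e2 := det_cons_single_last_casVecE (q := q) (G := G) n k (k - 2)
  have e2' := casDet_eq_casKappa_mul hq hc hG n k
  have e3 := detTwo_casVec_left G n (k - 1) d
  have e3' := casDet_eq_casKappa_mul' hq hc hG n (k + 1)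
  have e4 := detTwo_casVec_right G n (k - 2) e
  have e4' := det_cons_single_last_casBlk G (n + 1) (k - 2)
  have e5 := detTwo_casVec_left G n (k - 1) e
  have e5' := det_cons_single_last_casBlk G (n + 1) (k - 1)
  have e6 := detTwo_casVec_right G n (k - 2) d
  have e6' := casDet_eq_casKappa_mul hq hc hG (n + 1) k
  rw [show k - 1 - 1 = k - 2 by ring] at e1' e3 e5
  rw [show k + 1 - 2 = k - 1 by ring, show k + 1 - 1 = k by ring] at e3'
  rw [← hA, ← hb] at e1 e4 e6
  rw [← hA, ← hd, ← he] at e2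
  rw [← hA] at e3 e5
  rw [e1'] at e1
  rw [← hd] at e3' e6'
  rw [← he] at e4' e5'
  rw [e4'] at e4
  rw [e5'] at e5
  have k1 := casKappa_succ (c := c) hq n k
  have k3 := casKappa_shift hc (n + 1) k
  rw [detTwo_swap d e, detTwo_swap (casVec G (n + 2) (k - 1)) d, detTwo_swap b e,
    detTwo_swap (casVec G (n + 2) (k - 1)) e, detTwo_swap b d, e1, e2, e3, e4, e5, e6] at h
  rw [e2', e3', e6', k3]
  have hs : ((-1 : K) ^ n) * (-1) ^ n ≠ 0 := mul_ne_zero (pow_ne_zero _ (by simp)) (pow_ne_zero _ (by simp))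
  rw [pow_succ (-1 : K) n] at h
  apply mul_left_cancel₀ hs
  rw [k3] at k1
  set d2 := (Matrix.of (Matrix.vecCons (casVecE q G (n + 1) k)
    (casBlk G (n + 1) (k - 2) n))).det
  linear_combination q ^ (2 * n + 2) * casKappa q c (n + 1) (k + 1) * h
    - (-1) ^ n * (-1) ^ n * casDet G (n + 2) (k - 1) * d2 * k1

theorem casDet_toda (hq : q ≠ 0) (hc : ∀ k, c k = q * c (k + 1))
    (hG : ∀ k, G (k + 1) - G k + c k * G (k - 1) = 0) (n : ℕ) (k : ℤ) :
    q ^ (2 * n + 1) * (casDet G (n + 2) k * casDet G n (k - 1))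
      = c k * (casDet G (n + 1) k * casDet G (n + 1) (k - 1))
        - q ^ (2 * n + 2) * c k * (casDet G (n + 1) (k - 2) * casDet G (n + 1) (k + 1)) := by
  set b := casVecE q G (n + 2) (k - 1) with hb
  set A := casBlk G (n + 2) (k - 3) n with hA
  set e0 : Fin (n + 2) → K := Pi.single 0 1 with he0
  set e : Fin (n + 2) → K := Pi.single (Fin.last (n + 1)) 1 with he
  -- With both unit vectors present three sizes occur, which gives a recurrence in $n$.
  have h := detTwo_plucker (casVec G (n + 2) (k - 2)) b e0 e A
  have e1 := detTwo_casVec_left G n (k - 2) b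
  have e1' := casDet_eq_casKappa_mul' hq hc hG n k
  have e2 := detTwo_single_zero_last_casBlk G n (k - 3)
  have e3 := detTwo_casVec_left G n (k - 2) e0
  have e3' := det_cons_single_zero_casBlk G (n + 1) (k - 2)
  have e4 := det_cons_single_last_casVecE (q := q) (G := G) n (k - 1) (k - 3)
  have e4' := casDet_eq_casKappa_mul hq hc hG n (k - 1)
  have e5 := detTwo_casVec_left G n (k - 2) e
  have e5' := det_cons_single_last_casBlk G (n + 1) (k - 2)
  have e6 := det_cons_single_zero_casVecE (q := q) (G := G) n (k - 1) (k - 3)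
  have e6' := casDet_eq_casKappa_mul hq hc hG n (k + 1)
  rw [show k - 2 - 1 = k - 3 by ring] at e1 e3 e5
  rw [show k - 3 + 2 = k - 1 by ring] at e2
  rw [show k - 2 + 2 = k by ring] at e3'
  rw [show k - 1 - 2 = k - 3 by ring] at e4'
  rw [show k - 1 + 2 = k + 1 by ring, show k - 3 + 2 = k - 1 by ring] at e6
  rw [show k + 1 - 2 = k - 1 by ring] at e6'
  rw [← hA] at e1 e3 e5
  rw [← hA, ← he0, ← he] at e2
  rw [← hA, ← hb, ← he] at e4
  rw [← hA, ← hb, ← he0] at e6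
  rw [← hb] at e1'
  rw [← he0] at e3'
  rw [← he] at e5'
  rw [e3'] at e3
  rw [e5'] at e5
  have k1 := casKappa_succ (c := c) hq n k
  have k2 := casKappa_shift hc n k
  have k3 := casKappa_shift hc n (k - 1)
  rw [show k - 1 + 1 = k by ring] at k3
  rw [detTwo_swap _ b, detTwo_swap (casVec G (n + 2) (k - 2)) e0, detTwo_swap b e,
    detTwo_swap (casVec G (n + 2) (k - 2)) e, detTwo_swap b e0,
    e1, e2, e3, e4, e5, e6] at h
  rw [e1', e4', e6', k3, k2]
  set d1 := (Matrix.of (Matrix.vecCons b (casBlk G (n + 2) (k - 2) (n + 1)))).det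
  have hs : ((-1 : K) ^ n) ≠ 0 := pow_ne_zero _ (by simp)
  rw [pow_succ (-1 : K) n] at h
  apply mul_left_cancel₀ hs
  rw [k2] at k1
  have hqn : q ^ n ≠ 0 := pow_ne_zero _ hq
  have k4 : casKappa q c (n + 1) k * q = casKappa q c n (k + 1) * c k := by
    apply mul_left_cancel₀ hqn
    linear_combination k1
  set d4 := (Matrix.of (Matrix.vecCons (casVecE q G (n + 1) (k - 1))
    (casBlk G (n + 1) (k - 3) n))).det
  set d6 := (Matrix.of (Matrix.vecCons (casVecE q G (n + 1) (k + 1))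
    (casBlk G (n + 1) (k - 1) n))).det
  linear_combination -q ^ (2 * n + 1) * casKappa q c (n + 1) k * h
    + (-1) ^ n * q ^ (2 * n) * (casDet G (n + 1) k * d4
      - q ^ 2 * casDet G (n + 1) (k - 2) * d6) * k4

end Bilinear

/-! ### Difference equations of theta and elliptic gamma functions. -/

section InfiniteProducts

variable {q : ℂ}

theorem summable_norm_mul_pow (hq : ‖q‖ < 1) (a : ℂ) : Summable fun i : ℕ => ‖-(a * q ^ i)‖ := by
  simp only [norm_neg, norm_mul, norm_pow]
  exact (summable_geometric_of_lt_one (norm_nonneg _) hq).mul_left _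

theorem multipliable_qPochInf (hq : ‖q‖ < 1) (a : ℂ) :
    Multipliable fun i : ℕ => 1 - a * q ^ i := by
  simpa [sub_eq_add_neg] using multipliable_one_add_of_summable (summable_norm_mul_pow hq a)

theorem qPochInf_eq_mul (hq : ‖q‖ < 1) (a : ℂ) :
    qPochInf a q = (1 - a) * qPochInf (q * a) q := by
  have e : (fun i : ℕ => 1 - a * q ^ (i + 1)) = fun i => 1 - q * a * q ^ i := by
    ext i; ring
  unfold qPochInf
  rw [tprod_eq_zero_mul' (by rw [e]; exact multipliable_qPochInf hq _), e]
  simp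

theorem qPochInf_ne_zero (hq : ‖q‖ < 1) {a : ℂ} (ha : ∀ i : ℕ, a * q ^ i ≠ 1) :
    qPochInf a q ≠ 0 := by
  have := tprod_one_add_ne_zero_of_summable (f := fun i : ℕ => -(a * q ^ i))
    (fun i h => ha i (by linear_combination -h)) (summable_norm_mul_pow hq a)
  simpa [qPochInf, sub_eq_add_neg] using this

theorem Theta_mul (hq0 : q ≠ 0) (hq : ‖q‖ < 1) {a : ℂ} (ha : a ≠ 0) :
    Theta (q * a) q = -a⁻¹ * Theta a q := by
  have h1 := qPochInf_eq_mul hq a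
  have h2 := qPochInf_eq_mul hq a⁻¹
  have h3 : q * (q * a)⁻¹ = a⁻¹ := by field_simp
  rw [Theta, Theta, h3, h2, h1]
  field_simp
  ring

theorem Theta_ne_zero (hq0 : q ≠ 0) (hq : ‖q‖ < 1) {a : ℂ} (ha : a ≠ 0)
    (h : ∀ j : ℤ, a * q ^ j ≠ 1) : Theta a q ≠ 0 := by
  refine mul_ne_zero (qPochInf_ne_zero hq fun i => ?_) (qPochInf_ne_zero hq fun i hi => ?_)
  · exact_mod_cast h i
  · apply h (-(i + 1 : ℤ))
    rw [zpow_neg, show ((i : ℤ) + 1) = ((i + 1 : ℕ) : ℤ) by push_cast; ring, zpow_natCast]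
    field_simp
    rw [pow_succ]
    field_simp at hi
    linear_combination -hi

theorem multipliable_qPochInf₂ (hq : ‖q‖ < 1) (a : ℂ) :
    Multipliable fun ij : ℕ × ℕ => 1 - q ^ ij.1 * q ^ ij.2 * a := by
  have h1 := summable_geometric_of_lt_one (norm_nonneg _) hq
  have h2 : Summable fun ij : ℕ × ℕ => ‖-(q ^ ij.1 * q ^ ij.2 * a)‖ := by
    simp only [norm_neg, norm_mul, norm_pow]
    exact (h1.mul_of_nonneg h1 (fun i => by positivity) (fun i => by positivity)).mul_right _
  simpa [sub_eq_add_neg] using multipliable_one_add_of_summable h2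

theorem hasProd_qPochInf₂ (hq : ‖q‖ < 1) (a : ℂ) :
    HasProd (fun i : ℕ => qPochInf (q ^ i * a) q) (qPochInf₂ a q q) := by
  refine HasProd.prod_fiberwise (multipliable_qPochInf₂ hq a).hasProd fun i => ?_
  have := (multipliable_qPochInf hq (q ^ i * a)).hasProd
  convert this using 2
  · ring
  · rfl

theorem qPochInf₂_eq_mul (hq : ‖q‖ < 1) (a : ℂ) :
    qPochInf₂ a q q = qPochInf a q * qPochInf₂ (q * a) q q := by
  have e : (fun i : ℕ => qPochInf (q ^ (i + 1) * a) q) = fun i => qPochInf (q ^ i * (q * a)) q := by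
    ext i; congr 1; ring
  rw [← (hasProd_qPochInf₂ hq a).tprod_eq, ← (hasProd_qPochInf₂ hq (q * a)).tprod_eq,
    tprod_eq_zero_mul' (by rw [e]; exact (hasProd_qPochInf₂ hq _).multipliable), e]
  simp

/-- Both double products lose one simple product under $a\mapsto qa$, and these two products make up
$\Theta(a;q)$. The hypothesis allows division by $(a;q)_\infty$. -/
theorem ellGamma_mul (hq0 : q ≠ 0) (hq : ‖q‖ < 1) {a : ℂ} (ha0 : a ≠ 0)
    (ha : ∀ i : ℕ, a * q ^ i ≠ 1) :
    ellGamma (q * a) q q = Theta a q * ellGamma a q q := by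
  have h1 := qPochInf_ne_zero hq ha
  have h2 : q * q * (q * a)⁻¹ = q * a⁻¹ := by field_simp
  have h3 := qPochInf₂_eq_mul hq a
  have h4 := qPochInf₂_eq_mul hq (q * a⁻¹)
  rw [← mul_assoc] at h4
  rw [ellGamma, ellGamma, Theta, h2, h3, h4]
  -- If this product vanishes, both gamma values are quotients by zero, hence zero by convention.
  by_cases h5 : qPochInf₂ (q * a) q q = 0
  · simp [h5]
  · field_simp

end InfiniteProducts

/-! ### The series ${}_1\varphi_1(0;-p;p,w)$. -/

section Series

open Filter Topology

variable {p : ℂ}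

/-- The coefficients of `₁φ₁(0; -p; p, w)`. -/
def phiCoeff (p : ℂ) (n : ℕ) : ℂ :=
  qPoch 0 p n / (qPoch (-p) p n * qPoch p p n) * ((-1) ^ n * p ^ (n * (n - 1) / 2))

theorem onePhiOne_eq (p w : ℂ) : onePhiOne 0 (-p) p w = ∑' n, phiCoeff p n * w ^ n := rfl

theorem phiCoeff_zero (p : ℂ) : phiCoeff p 0 = 1 := by simp [phiCoeff, qPoch]

theorem one_sub_pow_ne_zero (hp : ‖p‖ < 1) (n : ℕ) : 1 - p ^ (n + 1) ≠ 0 := by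
  intro h
  have h1 : ‖p ^ (n + 1)‖ = 1 := by
    rw [show p ^ (n + 1) = 1 by linear_combination -h]; simp
  rw [norm_pow] at h1
  exact absurd h1 (pow_lt_one₀ (norm_nonneg _) hp (by simp)).ne

/-- The choice $b=-p$ merges the denominators: $(-p;p)_n(p;p)_n=(p^2;p^2)_n$. -/
theorem phiCoeff_succ (hp : ‖p‖ < 1) (n : ℕ) :
    phiCoeff p (n + 1) * (1 - p ^ (2 * (n + 1))) = -p ^ n * phiCoeff p n := by
  have h1 := one_sub_pow_ne_zero hp n
  have h2 := one_sub_pow_ne_zero hp (2 * n + 1)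
  have h3 : 1 - p ^ (2 * n + 1 + 1) = (1 - p ^ (n + 1)) * (1 + p ^ (n + 1)) := by ring
  have h4 : 1 + p ^ (n + 1) ≠ 0 := fun h => h2 (by rw [h3, h, mul_zero])
  have h5 : (n + 1) * (n + 1 - 1) / 2 = n * (n - 1) / 2 + n := by
    rcases n with _ | n
    · simp
    · simp only [Nat.add_sub_cancel]
      rw [show (n + 1 + 1) * (n + 1) = (n + 1) * n + (n + 1) * 2 by ring,
        Nat.add_mul_div_right _ _ (by norm_num)]
  have h6 : ∀ n, qPoch 0 p n = 1 := fun n => by simp [qPoch]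
  have h7 : qPoch p p (n + 1) = qPoch p p n * (1 - p ^ (n + 1)) := by
    rw [qPoch, Finset.prod_range_succ, qPoch]; congr 2; ring
  have h8 : qPoch (-p) p (n + 1) = qPoch (-p) p n * (1 + p ^ (n + 1)) := by
    rw [qPoch, Finset.prod_range_succ, qPoch]; congr 1; ring
  rw [phiCoeff, phiCoeff, h5, h6, h6, h7, h8,
    show 1 - p ^ (2 * (n + 1)) = (1 - p ^ (n + 1)) * (1 + p ^ (n + 1)) by ring, pow_add _ _ n]
  simp only [div_eq_mul_inv, mul_inv]
  generalize (qPoch (-p) p n)⁻¹ = b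
  generalize (qPoch p p n)⁻¹ = c
  generalize p ^ (n + 1) = x at h1 h4 ⊢
  field_simp
  ring

theorem summable_norm_phiCoeff (hp : ‖p‖ < 1) (w : ℂ) :
    Summable fun n => ‖phiCoeff p n * w ^ n‖ := by
  refine summable_of_ratio_norm_eventually_le (r := 1 / 2) (by norm_num) ?_
  have ht : Tendsto (fun n : ℕ => p ^ n * w) atTop (𝓝 0) := by
    simpa using (tendsto_pow_atTop_nhds_zero_of_norm_lt_one hp).mul_const w
  have ht2 : Tendsto (fun n : ℕ => (1 : ℂ) - p ^ (2 * (n + 1))) atTop (𝓝 1) := by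
    have h : Tendsto (fun n : ℕ => 2 * (n + 1)) atTop atTop :=
      tendsto_atTop_mono (fun n => by show n ≤ _; omega) tendsto_id
    simpa using ((tendsto_pow_atTop_nhds_zero_of_norm_lt_one hp).comp h).const_sub 1
  have h3 : Tendsto (fun n : ℕ => p ^ n * w / (1 - p ^ (2 * (n + 1)))) atTop (𝓝 0) := by
    have := ht.div ht2 one_ne_zero
    rwa [zero_div] at this
  have h4 := h3.norm
  rw [norm_zero] at h4
  filter_upwards [h4.eventually_le_const (show (0 : ℝ) < 1 / 2 by norm_num)] with n hn
  have h5 : 1 - p ^ (2 * (n + 1)) ≠ 0 := one_sub_pow_ne_zero hp (2 * n + 1)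
  have h6 : phiCoeff p (n + 1) * w ^ (n + 1)
      = -(p ^ n * w / (1 - p ^ (2 * (n + 1)))) * (phiCoeff p n * w ^ n) := by
    have := phiCoeff_succ hp n
    field_simp
    rw [pow_succ]
    linear_combination w ^ n * w * this
  rw [Real.norm_of_nonneg (norm_nonneg _), Real.norm_of_nonneg (norm_nonneg _), h6, norm_mul,
    norm_neg]
  gcongr

theorem summable_phiCoeff (hp : ‖p‖ < 1) (w : ℂ) : Summable fun n => phiCoeff p n * w ^ n :=
  (summable_norm_phiCoeff hp w).of_norm

/-- Comparing coefficients of $w^{n+1}$ reduces this to `phiCoeff_succ`. -/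
theorem onePhiOne_qdiff (hp0 : p ≠ 0) (hp : ‖p‖ < 1) (w : ℂ) :
    onePhiOne 0 (-p) p (w / p) + w / p * onePhiOne 0 (-p) p w = onePhiOne 0 (-p) p (p * w) := by
  simp only [onePhiOne_eq]
  have s1 := summable_phiCoeff hp (w / p)
  have s2 := summable_phiCoeff hp (p * w)
  rw [s1.tsum_eq_zero_add, s2.tsum_eq_zero_add, ← tsum_mul_left]
  simp only [pow_zero, mul_one]
  rw [add_assoc, ← Summable.tsum_add ((summable_nat_add_iff 1).2 s1)
    ((summable_phiCoeff hp w).mul_left _)]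
  congr 1
  refine tsum_congr fun n => ?_
  have h := phiCoeff_succ hp n
  rw [div_pow, mul_pow]
  field_simp
  have e : p ^ (2 * (n + 1)) = p ^ n * p ^ n * p ^ 2 := by ring
  rw [e] at h
  simp only [pow_succ]
  linear_combination w ^ n * w * p * h

theorem tendsto_onePhiOne (hp : ‖p‖ < 1) (w : ℂ) :
    Tendsto (fun m : ℕ => onePhiOne 0 (-p) p (p ^ m * w)) atTop (𝓝 1) := by
  have h : Tendsto (fun m : ℕ => ∑' n, phiCoeff p n * (p ^ m * w) ^ n) atTop
      (𝓝 (∑' n, if n = 0 then (1 : ℂ) else 0)) := by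
    refine tendsto_tsum_of_dominated_convergence (summable_norm_phiCoeff hp w) (fun n => ?_)
      (Eventually.of_forall fun m n => ?_)
    · rcases n with _ | n
      · simp [phiCoeff_zero]
      · have ht : Tendsto (fun m : ℕ => p ^ m * w) atTop (𝓝 0) := by
          simpa using (tendsto_pow_atTop_nhds_zero_of_norm_lt_one hp).mul_const w
        simpa using (ht.pow (n + 1)).const_mul (phiCoeff p (n + 1))
    · rw [norm_mul, norm_mul, norm_pow, norm_pow, norm_mul, norm_pow]
      gcongr
      exact mul_le_of_le_one_left (norm_nonneg _) (pow_le_one₀ (norm_nonneg _) hp.le)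
  simpa [onePhiOne_eq] using h

/-- The Casoratian of the two solutions of the three-term relation, without theta factors. -/
theorem onePhiOne_casorati (hp0 : p ≠ 0) (hp : ‖p‖ < 1) (w : ℂ) :
    onePhiOne 0 (-p) p (p * w) * onePhiOne 0 (-p) p (-w)
      + onePhiOne 0 (-p) p w * onePhiOne 0 (-p) p (-(p * w)) = 2 := by
  set F := fun w => onePhiOne 0 (-p) p w with hF
  -- Two instances of the difference equation, at $pw$ and $-pw$, show that the expression is
  -- invariant under $w\mapsto pw$. Its value is therefore its limit at $w=0$.
  have step : ∀ w, F (p * w) * F (-w) + F w * F (-(p * w))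
      = F (p * (p * w)) * F (-(p * w)) + F (p * w) * F (-(p * (p * w))) := by
    intro w
    have h1 := onePhiOne_qdiff hp0 hp (p * w)
    have h2 := onePhiOne_qdiff hp0 hp (p * -w)
    rw [mul_div_cancel_left₀ _ hp0] at h1 h2
    simp only [mul_neg] at h2
    simp only [hF]
    linear_combination onePhiOne 0 (-p) p (-(p * w)) * h1 + onePhiOne 0 (-p) p (p * w) * h2
  have const : ∀ m : ℕ, F (p * (p ^ m * w)) * F (-(p ^ m * w))
      + F (p ^ m * w) * F (-(p * (p ^ m * w))) = F (p * w) * F (-w) + F w * F (-(p * w)) := by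
    intro m
    induction m with
    | zero => simp
    | succ m ih => rw [← ih, step (p ^ m * w), pow_succ']; simp only [mul_assoc]
  have t1 : ∀ w, Tendsto (fun m : ℕ => F (p ^ m * w)) atTop (𝓝 1) := tendsto_onePhiOne hp
  have t2 := ((t1 (p * w)).mul (t1 (-w))).add ((t1 w).mul (t1 (-(p * w))))
  have t3 : Tendsto (fun _ : ℕ => F (p * w) * F (-w) + F w * F (-(p * w))) atTop
      (𝓝 (1 * 1 + 1 * 1)) := by
    refine t2.congr fun m => ?_
    rw [← const m]
    simp only [mul_left_comm p (p ^ m), mul_neg]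
  have := tendsto_nhds_unique tendsto_const_nhds t3
  rw [this]; norm_num

end Series

/-! ### Solutions of the three-term relation. -/

section Entries

/-- The basic solution `Θ(z;p) ₁φ₁(0;-p;p,-pz)`. -/
def thetaPhi (p z : ℂ) : ℂ := Theta z p * onePhiOne 0 (-p) p (-p * z)

/-- The multipliers of $\Theta$ at $pz$ and $p^2z$ are $-z^{-1}$ and $(pz^2)^{-1}$, and they turn
the equation for ${}_1\varphi_1$ into this one. The result is even in $z$, which is the source of
the second solution. -/
theorem thetaPhi_qdiff {p z : ℂ} (hp0 : p ≠ 0) (hp : ‖p‖ < 1) (hz : z ≠ 0) :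
    thetaPhi p (p * (p * z)) - thetaPhi p (p * z) - (p * z ^ 2)⁻¹ * thetaPhi p z = 0 := by
  have h1 := Theta_mul hp0 hp hz
  have h2 := Theta_mul hp0 hp (mul_ne_zero hp0 hz)
  have h3 := onePhiOne_qdiff hp0 hp (-p * (p * z))
  rw [show -p * (p * z) / p = -p * z by field_simp,
    show p * (-p * (p * z)) = -p * (p * (p * z)) by ring] at h3
  rw [thetaPhi, thetaPhi, thetaPhi, h2, h1, ← h3]
  field_simp
  ring

theorem thetaPhi_casorati {p z : ℂ} (hp0 : p ≠ 0) (hp : ‖p‖ < 1) (hz : z ≠ 0) :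
    thetaPhi p (p * z) * thetaPhi p (-z) - thetaPhi p z * thetaPhi p (-(p * z))
      = -2 * z⁻¹ * (Theta z p * Theta (-z) p) := by
  have h1 := Theta_mul hp0 hp hz
  have h2 := Theta_mul hp0 hp (neg_ne_zero.2 hz)
  have h3 := onePhiOne_casorati hp0 hp (-p * z)
  rw [mul_neg] at h2
  rw [show -(-p * z) = -p * -z by ring, show p * (-p * z) = -p * (p * z) by ring,
    show -(-p * (p * z)) = -p * -(p * z) by ring] at h3
  rw [thetaPhi, thetaPhi, thetaPhi, thetaPhi, h2, h1, ← h3]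
  field_simp
  ring

variable {h α₀ : ℂ}

/-- The argument of the theta function in `G_k`. -/
def entryArg (h α₀ : ℂ) (k : ℤ) : ℂ := I * α₀ ^ 6 * (h ^ 3) ^ (2 * k + 1)

theorem entryArg_ne_zero (h_ne : h ≠ 0) (hα : α₀ ≠ 0) (k : ℤ) : entryArg h α₀ k ≠ 0 := by
  unfold entryArg
  exact mul_ne_zero (mul_ne_zero I_ne_zero (pow_ne_zero _ hα)) (zpow_ne_zero _ (pow_ne_zero _ h_ne))

theorem entryArg_succ (h_ne : h ≠ 0) (k : ℤ) :
    entryArg h α₀ (k + 1) = h ^ 6 * entryArg h α₀ k := by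
  have h3 : h ^ 3 ≠ 0 := pow_ne_zero _ h_ne
  rw [entryArg, entryArg, show 2 * (k + 1) + 1 = (2 * k + 1) + 2 by ring, zpow_add₀ h3]
  norm_cast
  ring

theorem entryG_eq (h_ne : h ≠ 0) (A B : ℂ → ℂ) (k : ℤ) :
    entryG h A B k α₀ = A (h ^ k * α₀) * thetaPhi (h ^ 6) (entryArg h α₀ k)
      + B (h ^ k * α₀) * thetaPhi (h ^ 6) (-entryArg h α₀ k) := by
  have h3 : h ^ 3 ≠ 0 := pow_ne_zero _ h_ne
  have e : (h ^ 3) ^ (3 + 2 * k) = h ^ 6 * (h ^ 3) ^ (2 * k + 1) := by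
    rw [show 3 + 2 * k = (2 * k + 1) + 2 by ring, zpow_add₀ h3]
    norm_cast
    ring
  have e1 : -I * α₀ ^ 6 * (h ^ 3) ^ (3 + 2 * k) = -h ^ 6 * entryArg h α₀ k := by
    rw [e, entryArg]; ring
  have e2 : I * α₀ ^ 6 * (h ^ 3) ^ (3 + 2 * k) = -h ^ 6 * -entryArg h α₀ k := by
    rw [e, entryArg]; ring
  have e3 : -I * α₀ ^ 6 * (h ^ 3) ^ (2 * k + 1) = -entryArg h α₀ k := by
    rw [entryArg]; ring
  rw [entryG, e1, e2, e3, thetaPhi, thetaPhi, ← entryArg]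
  ring

theorem IsPeriodic.zpow_mul {A : ℂ → ℂ} (hA : IsPeriodic h A) (h_ne : h ≠ 0) (k : ℤ) (a : ℂ) :
    A (h ^ k * a) = A a := by
  induction k with
  | zero => simp
  | succ n ih => rw [← ih, zpow_add_one₀ h_ne, mul_comm (h ^ (n : ℤ)) h, mul_assoc, hA]
  | pred n ih =>
    rw [← ih, ← hA (h ^ (-(n : ℤ) - 1) * a), ← mul_assoc, ← zpow_one_add₀ h_ne,
      show 1 + (-(n : ℤ) - 1) = -n by ring]

/-- The coefficient `a_0^{-2} q^{-k}` of the three-term relation. -/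
def threeCoeff (h α₀ : ℂ) (k : ℤ) : ℂ := (α₀ ^ 6) ^ (-2 : ℤ) * (h ^ 12) ^ (-k)

theorem threeCoeff_ne_zero (h_ne : h ≠ 0) (hα : α₀ ≠ 0) (k : ℤ) : threeCoeff h α₀ k ≠ 0 :=
  mul_ne_zero (zpow_ne_zero _ (pow_ne_zero _ hα)) (zpow_ne_zero _ (pow_ne_zero _ h_ne))

theorem threeCoeff_succ (h_ne : h ≠ 0) (k : ℤ) :
    threeCoeff h α₀ k = h ^ 12 * threeCoeff h α₀ (k + 1) := by
  have h12 : h ^ 12 ≠ 0 := pow_ne_zero _ h_ne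
  rw [threeCoeff, threeCoeff, show -k = 1 + -(k + 1) by ring, zpow_add₀ h12, zpow_one]
  ring

theorem threeCoeff_eq (k : ℤ) :
    threeCoeff h α₀ k = ((h ^ k * α₀) ^ 12)⁻¹ := by
  have e1 : (α₀ ^ 6) ^ (-2 : ℤ) = (α₀ ^ 12)⁻¹ := by
    rw [zpow_neg]; norm_cast; rw [← pow_mul]
  have e2 : (h ^ 12) ^ (-k) = ((h ^ k) ^ 12)⁻¹ := by
    rw [zpow_neg]
    congr 1
    rw [← zpow_natCast, ← zpow_natCast, ← zpow_mul, ← zpow_mul, mul_comm]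
  rw [threeCoeff, e1, e2, mul_pow, mul_inv, mul_comm]

/-- The factor $i$ in the argument accounts for the sign. -/
theorem threeCoeff_eq_entryArg (h_ne : h ≠ 0) (k : ℤ) :
    threeCoeff h α₀ k = -(h ^ 6 * entryArg h α₀ (k - 1) ^ 2)⁻¹ := by
  have e : h ^ 6 * ((h ^ 3) ^ (2 * (k - 1) + 1)) ^ 2 = (h ^ k) ^ 12 := by
    rw [← zpow_natCast, ← zpow_natCast, ← zpow_natCast, ← zpow_natCast, ← zpow_mul, ← zpow_mul,
      ← zpow_mul, ← zpow_add₀ h_ne]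
    congr 1; push_cast; ring
  rw [threeCoeff_eq, entryArg, ← inv_neg, mul_pow, ← e, mul_pow, mul_pow, I_sq]
  congr 1; ring

theorem threeTerm_thetaPhi (h_ne : h ≠ 0) (h_lt : ‖h‖ < 1) (hα : α₀ ≠ 0) :
    ThreeTerm h α₀ (fun k => thetaPhi (h ^ 6) (entryArg h α₀ k)) := by
  intro k
  have hp0 : h ^ 6 ≠ 0 := pow_ne_zero _ h_ne
  have hp : ‖h ^ 6‖ < 1 := by
    rw [norm_pow]; exact pow_lt_one₀ (norm_nonneg _) h_lt (by norm_num)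
  have e1 := entryArg_succ (α₀ := α₀) h_ne k
  have e2 := entryArg_succ (α₀ := α₀) h_ne (k - 1)
  rw [sub_add_cancel] at e2
  have := thetaPhi_qdiff hp0 hp (entryArg_ne_zero h_ne hα (k - 1))
  have e3 := threeCoeff_eq_entryArg (α₀ := α₀) h_ne k
  rw [threeCoeff] at e3
  simp only [e1, e2, e3]
  linear_combination this

theorem threeTerm_thetaPhi_neg (h_ne : h ≠ 0) (h_lt : ‖h‖ < 1) (hα : α₀ ≠ 0) :
    ThreeTerm h α₀ (fun k => thetaPhi (h ^ 6) (-entryArg h α₀ k)) := by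
  intro k
  have hp0 : h ^ 6 ≠ 0 := pow_ne_zero _ h_ne
  have hp : ‖h ^ 6‖ < 1 := by
    rw [norm_pow]; exact pow_lt_one₀ (norm_nonneg _) h_lt (by norm_num)
  have e1 := entryArg_succ (α₀ := α₀) h_ne k
  have e2 := entryArg_succ (α₀ := α₀) h_ne (k - 1)
  rw [sub_add_cancel] at e2
  have := thetaPhi_qdiff hp0 hp (neg_ne_zero.2 (entryArg_ne_zero h_ne hα (k - 1)))
  have e3 := threeCoeff_eq_entryArg (α₀ := α₀) h_ne k
  rw [threeCoeff] at e3
  simp only [e1, e2, e3]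
  rw [neg_sq] at this
  simp only [mul_neg] at this
  linear_combination this

theorem ThreeTerm.linear {G₁ G₂ : ℤ → ℂ} (h₁ : ThreeTerm h α₀ G₁) (h₂ : ThreeTerm h α₀ G₂)
    (a b : ℂ) : ThreeTerm h α₀ (fun k => a * G₁ k + b * G₂ k) := by
  intro k
  linear_combination a * h₁ k + b * h₂ k

theorem threeTerm_entryG (h_ne : h ≠ 0) (h_lt : ‖h‖ < 1) {A B : ℂ → ℂ} (hA : IsPeriodic h A)
    (hB : IsPeriodic h B) (hα : α₀ ≠ 0) : ThreeTerm h α₀ (fun k => entryG h A B k α₀) := by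
  simp only [entryG_eq h_ne, hA.zpow_mul h_ne, hB.zpow_mul h_ne]
  exact (threeTerm_thetaPhi h_ne h_lt hα).linear (threeTerm_thetaPhi_neg h_ne h_lt hα) _ _

/-- The coefficient of $G_{k-1}$ does not vanish, so the recurrence runs in both directions. -/
theorem ThreeTerm.ext {G₁ G₂ : ℤ → ℂ} (h_ne : h ≠ 0) (hα : α₀ ≠ 0) (h₁ : ThreeTerm h α₀ G₁)
    (h₂ : ThreeTerm h α₀ G₂) (e0 : G₁ 0 = G₂ 0) (e1 : G₁ 1 = G₂ 1) (k : ℤ) : G₁ k = G₂ k := by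
  suffices G₁ k = G₂ k ∧ G₁ (k + 1) = G₂ (k + 1) from this.1
  induction k with
  | zero => exact ⟨e0, by simpa using e1⟩
  | succ n ih =>
    refine ⟨ih.2, ?_⟩
    have a1 := h₁ (n + 1)
    have a2 := h₂ (n + 1)
    rw [add_sub_cancel_right, ih.1, ih.2] at a1
    rw [add_sub_cancel_right] at a2
    linear_combination a1 - a2
  | pred n ih =>
    rw [sub_add_cancel]
    refine ⟨?_, ih.1⟩
    have a1 := h₁ (-n)
    have a2 := h₂ (-n)
    rw [ih.1, ih.2] at a1
    have hc := threeCoeff_ne_zero h_ne hα (-(n : ℤ))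
    rw [threeCoeff] at hc
    apply mul_left_cancel₀ hc
    linear_combination a1 - a2

theorem entryG_casorati_ne_zero (h_ne : h ≠ 0) (h_lt : ‖h‖ < 1) (hα : α₀ ≠ 0)
    (hΘ : ThetaNonzero h α₀) :
    thetaPhi (h ^ 6) (entryArg h α₀ 1) * thetaPhi (h ^ 6) (-entryArg h α₀ 0)
      - thetaPhi (h ^ 6) (entryArg h α₀ 0) * thetaPhi (h ^ 6) (-entryArg h α₀ 1) ≠ 0 := by
  have hp0 : h ^ 6 ≠ 0 := pow_ne_zero _ h_ne
  have hp : ‖h ^ 6‖ < 1 := by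
    rw [norm_pow]; exact pow_lt_one₀ (norm_nonneg _) h_lt (by norm_num)
  have hz := entryArg_ne_zero h_ne hα 0
  have e1 := entryArg_succ (α₀ := α₀) h_ne 0
  rw [zero_add] at e1
  rw [e1, thetaPhi_casorati hp0 hp hz]
  have e0 : entryArg h α₀ 0 = I * α₀ ^ 6 * h ^ 3 := by simp [entryArg]
  have e0' : -entryArg h α₀ 0 = -I * α₀ ^ 6 * h ^ 3 := by rw [e0]; ring
  refine mul_ne_zero (mul_ne_zero (by norm_num) (inv_ne_zero hz)) (mul_ne_zero ?_ ?_)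
  · rw [e0]; exact hΘ.1
  · rw [e0']; exact hΘ.2

theorem exists_entryG_eq (h_ne : h ≠ 0) (h_lt : ‖h‖ < 1) (hα : α₀ ≠ 0) (hΘ : ThetaNonzero h α₀)
    {G : ℤ → ℂ} (hG : ThreeTerm h α₀ G) :
    ∃ a b : ℂ, ∀ k, G k = entryG h (fun _ => a) (fun _ => b) k α₀ := by
  have hW := entryG_casorati_ne_zero h_ne h_lt hα hΘ
  set u0 := thetaPhi (h ^ 6) (entryArg h α₀ 0)
  set u1 := thetaPhi (h ^ 6) (entryArg h α₀ 1)
  set v0 := thetaPhi (h ^ 6) (-entryArg h α₀ 0)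
  set v1 := thetaPhi (h ^ 6) (-entryArg h α₀ 1)
  -- Cramer's rule for the initial values at $k=0,1$.
  refine ⟨(G 1 * v0 - G 0 * v1) / (u1 * v0 - u0 * v1),
    (u1 * G 0 - u0 * G 1) / (u1 * v0 - u0 * v1), ?_⟩
  refine ThreeTerm.ext h_ne hα hG
    (threeTerm_entryG h_ne h_lt (fun _ => rfl) (fun _ => rfl) hα) ?_ ?_
  · simp only [entryG_eq h_ne]
    change G 0 = _ * u0 + _ * v0
    rw [div_mul_eq_mul_div, div_mul_eq_mul_div, ← add_div, eq_div_iff hW]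
    ring
  · simp only [entryG_eq h_ne]
    change G 1 = _ * u1 + _ * v1
    rw [div_mul_eq_mul_div, div_mul_eq_mul_div, ← add_div, eq_div_iff hW]
    ring

/-- Uniqueness of the coefficients is what later makes pointwise chosen coefficients periodic. -/
theorem entryG_const_injective (h_ne : h ≠ 0) (h_lt : ‖h‖ < 1) (hα : α₀ ≠ 0)
    (hΘ : ThetaNonzero h α₀) {a b a' b' : ℂ}
    (H : ∀ k, entryG h (fun _ => a) (fun _ => b) k α₀
      = entryG h (fun _ => a') (fun _ => b') k α₀) : a = a' ∧ b = b' := by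
  have hW := entryG_casorati_ne_zero h_ne h_lt hα hΘ
  have H0 := H 0
  have H1 := H 1
  rw [entryG_eq h_ne, entryG_eq h_ne] at H0 H1
  set u0 := thetaPhi (h ^ 6) (entryArg h α₀ 0)
  set u1 := thetaPhi (h ^ 6) (entryArg h α₀ 1)
  set v0 := thetaPhi (h ^ 6) (-entryArg h α₀ 0)
  set v1 := thetaPhi (h ^ 6) (-entryArg h α₀ 1)
  constructor
  · apply mul_right_cancel₀ hW
    linear_combination v0 * H1 - v1 * H0
  · apply mul_right_cancel₀ hW
    linear_combination u1 * H0 - u0 * H1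

theorem entryArg_shift (h_ne : h ≠ 0) (k l : ℤ) :
    entryArg h (h ^ l * α₀) k = entryArg h α₀ (k + l) := by
  have h3 : h ^ 3 ≠ 0 := pow_ne_zero _ h_ne
  have e : (h ^ l) ^ 6 = (h ^ 3) ^ (2 * l) := by
    rw [← zpow_natCast, ← zpow_natCast, ← zpow_mul, ← zpow_mul]; congr 1; push_cast; ring
  rw [entryArg, entryArg, show 2 * (k + l) + 1 = 2 * l + (2 * k + 1) by ring,
    zpow_add₀ h3 (2 * l) (2 * k + 1), mul_pow, e]
  ring

theorem entryG_shift (h_ne : h ≠ 0) (A B : ℂ → ℂ) (k l : ℤ) :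
    entryG h A B k (h ^ l * α₀) = entryG h A B (k + l) α₀ := by
  rw [entryG_eq h_ne, entryG_eq h_ne, entryArg_shift h_ne, ← mul_assoc, ← zpow_add₀ h_ne]

end Entries

/-! ### The identities for $\phi_N^k$ with integer $N$. -/

section PhiDet

variable {h α₀ : ℂ} {G : ℤ → ℂ}

theorem phiDet_natCast (G : ℤ → ℂ) (k : ℤ) (n : ℕ) : phiDet G k n = casDet G n k := by
  rw [phiDet, if_neg (by omega), casDet, ← Matrix.det_transpose]
  simp only [Int.toNat_natCast]
  congr 1
  ext i j
  simp only [Matrix.transpose_apply, Matrix.of_apply, casBlk, casVec]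
  congr 1; ring

theorem phiDet_neg (G : ℤ → ℂ) (k : ℤ) {N : ℤ} (hN : N < 0) : phiDet G k N = 0 := if_pos hN

theorem phiDet_zero (G : ℤ → ℂ) (k : ℤ) : phiDet G k 0 = 1 := by
  simpa [casDet_zero] using phiDet_natCast G k 0

theorem phiDet_one (G : ℤ → ℂ) (k : ℤ) : phiDet G k 1 = G k := by
  simpa [casDet_one] using phiDet_natCast G k 1

theorem phiDet_shift (G : ℤ → ℂ) (k l N : ℤ) :
    phiDet (fun m => G (m + l)) k N = phiDet G (k + l) N := by
  unfold phiDet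
  split_ifs
  · rfl
  · congr 1
    ext i j
    simp only [Matrix.of_apply]
    congr 1; ring

/-- The case $N=-1$ is included because $T_4^{-1}$ at level zero involves $\phi_{-1}$. -/
theorem phiDet_jacobi (G : ℤ → ℂ) (k : ℤ) {N : ℤ} (hN : -1 ≤ N) :
    phiDet G k (N + 2) * phiDet G (k + 1) N
      = phiDet G k (N + 1) * phiDet G (k + 1) (N + 1)
        - phiDet G (k + 2) (N + 1) * phiDet G (k - 1) (N + 1) := by
  rcases hN.eq_or_lt with rfl | hN
  · rw [phiDet_neg G (k + 1) (by norm_num)]; simp [phiDet_zero]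
  · obtain ⟨n, rfl⟩ := Int.eq_ofNat_of_zero_le (show 0 ≤ N by omega)
    have := casDet_jacobi G n k
    simp only [← phiDet_natCast] at this
    exact_mod_cast this

theorem phiDet_toda (h_ne : h ≠ 0) (hG : ThreeTerm h α₀ G) (k : ℤ) {N : ℤ} (hN : -1 ≤ N) :
    h ^ 12 * ((h ^ 12) ^ N) ^ 2 * (phiDet G k (N + 2) * phiDet G (k - 1) N)
      = threeCoeff h α₀ k * (phiDet G k (N + 1) * phiDet G (k - 1) (N + 1)
        - h ^ 24 * ((h ^ 12) ^ N) ^ 2 *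
          (phiDet G (k - 2) (N + 1) * phiDet G (k + 1) (N + 1))) := by
  rcases hN.eq_or_lt with rfl | hN
  · rw [phiDet_neg G (k - 1) (by norm_num)]
    simp only [phiDet_zero, neg_add_cancel, zpow_neg_one]
    have : h ^ 24 * ((h ^ 12)⁻¹) ^ 2 = 1 := by field_simp
    rw [this]; ring
  · obtain ⟨n, rfl⟩ := Int.eq_ofNat_of_zero_le (show 0 ≤ N by omega)
    have := casDet_toda (pow_ne_zero 12 h_ne) (threeCoeff_succ (α₀ := α₀) h_ne) hG n k
    simp only [← phiDet_natCast] at this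
    push_cast at this
    rw [zpow_natCast]
    linear_combination this

theorem phiDet_bilinear_up (h_ne : h ≠ 0) (hG : ThreeTerm h α₀ G) (k : ℤ) {N : ℤ} (hN : 0 ≤ N) :
    ((h ^ 12) ^ N) ^ 2 * (phiDet G (k + 1) (N + 1) * phiDet G (k - 2) N)
      = (h ^ 12) ^ N * (phiDet G k (N + 1) * phiDet G (k - 1) N)
        - threeCoeff h α₀ k * (phiDet G k N * phiDet G (k - 1) (N + 1)) := by
  obtain ⟨n, rfl⟩ := Int.eq_ofNat_of_zero_le hN
  have := casDet_bilinear_up (pow_ne_zero 12 h_ne) (threeCoeff_succ (α₀ := α₀) h_ne) hG n k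
  simp only [← phiDet_natCast] at this
  push_cast at this
  rw [zpow_natCast]
  linear_combination this

theorem phiDet_bilinear_down (h_ne : h ≠ 0) (hG : ThreeTerm h α₀ G) (k : ℤ) {N : ℤ}
    (hN : 0 ≤ N) :
    (h ^ 12) ^ N * (phiDet G k (N + 1) * phiDet G (k - 1) N)
      - phiDet G k N * phiDet G (k - 1) (N + 1)
      + (h ^ 12) ^ N * threeCoeff h α₀ (k - 1)
        * (phiDet G (k - 2) (N + 1) * phiDet G (k + 1) N) = 0 := by
  obtain ⟨n, rfl⟩ := Int.eq_ofNat_of_zero_le hN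
  have := casDet_bilinear_down (pow_ne_zero 12 h_ne) (threeCoeff_succ (α₀ := α₀) h_ne) hG n k
  simp only [← phiDet_natCast] at this
  push_cast at this
  rw [zpow_natCast]
  linear_combination this

end PhiDet

/-! ### The prefactor of $\phi_N^k$ as a function of $x=Q^{k/2}\alpha_0$. -/

section Gauge

variable {h α₀ x y : ℂ}

theorem IsGeneric.shift (h_ne : h ≠ 0) (hg : IsGeneric h α₀) (l : ℤ) :
    IsGeneric h (h ^ l * α₀) := by
  refine ⟨mul_ne_zero (zpow_ne_zero _ h_ne) hg.1, fun j => ⟨fun e => ?_, fun e => ?_, fun e => ?_⟩⟩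
  · apply (hg.2 (j - l)).1
    rw [zpow_sub₀ h_ne, eq_div_iff (zpow_ne_zero _ h_ne), ← e, mul_comm]
  · apply (hg.2 (j - l)).2.1
    rw [show 2 * (j - l) + 1 = 2 * j + 1 - 2 * l by ring, zpow_sub₀ h_ne,
      eq_div_iff (zpow_ne_zero _ h_ne), ← e, mul_pow, mul_comm 2 l, zpow_mul]
    norm_cast
    ring
  · apply (hg.2 (j - l)).2.2
    rw [show 6 * (j - l) - 2 = 6 * j - 2 - 6 * l by ring, zpow_sub₀ h_ne,
      eq_div_iff (zpow_ne_zero _ h_ne), ← e, mul_pow, mul_comm 6 l, zpow_mul]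
    norm_cast
    ring

/-- The theta function in the denominator of `τ_N^k`, at `x = Q^{k/2} α₀`. -/
def thetaG (h x : ℂ) : ℂ := Theta (h ^ 2 * x ^ 6) ((h ^ 2) ^ 3)

/-- The product of gamma functions in `τ_N^k`, at `x = Q^{k/2} α₀`. -/
def gammaG (h x : ℂ) : ℂ :=
  ellGamma (h ^ 3 * x ^ 2) (h ^ 2) (h ^ 2) * ellGamma x⁻¹ (h ^ 2) (h ^ 2)
    * ellGamma (h ^ 3 * x⁻¹) (h ^ 2) (h ^ 2)

/-- The elementary prefactor of `φ_N^k` in `τ_N^k`, at `x = Q^{k/2} α₀`. -/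
def gaugeM (h x : ℂ) (N : ℤ) : ℂ :=
  (-1) ^ (N * (N - 1) / 2) * (h ^ 2) ^ (N * (N - 1) * N) * x ^ (2 * N * (N - 1)) / thetaG h x ^ N

/-- The ratio `gaugeM h x (N + 1) / gaugeM h x N`. -/
def gaugeMu (h x : ℂ) (N : ℤ) : ℂ :=
  (-1) ^ N * (h ^ 2) ^ (3 * N ^ 2 + N) * x ^ (4 * N) / thetaG h x

theorem gammaFactor_eq (h_ne : h ≠ 0) (k : ℤ) (α₀ : ℂ) :
    gammaFactor h k α₀ = gammaG h (h ^ k * α₀) := by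
  have e1 : h ^ (2 * k + 3) * α₀ ^ 2 = h ^ 3 * (h ^ k * α₀) ^ 2 := by
    rw [zpow_add₀ h_ne, mul_comm 2 k, zpow_mul]; norm_cast; ring
  have e2 : h ^ (-k) * α₀⁻¹ = (h ^ k * α₀)⁻¹ := by rw [zpow_neg, mul_inv]
  have e3 : h ^ (-k + 3) * α₀⁻¹ = h ^ 3 * (h ^ k * α₀)⁻¹ := by
    rw [zpow_add₀ h_ne, zpow_neg, mul_inv]; norm_cast; ring
  rw [gammaFactor, gammaG, e1, e2, e3]

theorem hyperTau_eq (h_ne : h ≠ 0) (A B : ℂ → ℂ) (k N : ℤ) (α₀ : ℂ) :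
    hyperTau h A B k N α₀ = gaugeM h (h ^ k * α₀) N * gammaG h (h ^ k * α₀)
      * phiDet (fun l => entryG h A B l α₀) k N := by
  have hQ : h ^ 2 ≠ 0 := pow_ne_zero _ h_ne
  have e1 : (h ^ 2) ^ (3 * k + 1) * α₀ ^ 6 = h ^ 2 * (h ^ k * α₀) ^ 6 := by
    have : (h ^ 2) ^ (3 * k) = (h ^ k) ^ 6 := by
      rw [← zpow_natCast, ← zpow_natCast, ← zpow_mul, ← zpow_mul]; congr 1; push_cast; ring
    rw [zpow_add₀ hQ, zpow_one, this]; ring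
  have e2 : (h ^ 2) ^ (N * (N - 1) * (k + N)) * α₀ ^ (2 * N * (N - 1))
      = (h ^ 2) ^ (N * (N - 1) * N) * (h ^ k * α₀) ^ (2 * N * (N - 1)) := by
    have : (h ^ 2) ^ (N * (N - 1) * k) = (h ^ k) ^ (2 * N * (N - 1)) := by
      rw [← zpow_natCast, ← zpow_mul, ← zpow_mul]; congr 1; push_cast; ring
    rw [mul_zpow, ← this, mul_add, zpow_add₀ hQ]; ring
  rw [hyperTau, e1, gammaFactor_eq h_ne, gaugeM, thetaG, mul_assoc ((-1) ^ (N * (N - 1) / 2)), e2]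
  ring

theorem norm_pow_lt_one (h_lt : ‖h‖ < 1) {n : ℕ} (hn : n ≠ 0) : ‖h ^ n‖ < 1 := by
  rw [norm_pow]; exact pow_lt_one₀ (norm_nonneg _) h_lt hn

theorem thetaG_mul (h_ne : h ≠ 0) (h_lt : ‖h‖ < 1) (hx : x ≠ 0) :
    h ^ 2 * x ^ 6 * thetaG h (h * x) = -thetaG h x := by
  have hQ : (h ^ 2) ^ 3 ≠ 0 := pow_ne_zero _ (pow_ne_zero _ h_ne)
  have ha : h ^ 2 * x ^ 6 ≠ 0 := by positivity
  have := Theta_mul hQ (by rw [← pow_mul]; exact norm_pow_lt_one h_lt (by norm_num)) ha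
  rw [thetaG, show h ^ 2 * (h * x) ^ 6 = (h ^ 2) ^ 3 * (h ^ 2 * x ^ 6) by ring, this, thetaG]
  field_simp

theorem thetaG_ne_zero (h_ne : h ≠ 0) (h_lt : ‖h‖ < 1) (hg : IsGeneric h x) :
    thetaG h x ≠ 0 := by
  have hQ : (h ^ 2) ^ 3 ≠ 0 := pow_ne_zero _ (pow_ne_zero _ h_ne)
  have hx := hg.1
  refine Theta_ne_zero hQ (by rw [← pow_mul]; exact norm_pow_lt_one h_lt (by norm_num))
    (by positivity) fun j e => (hg.2 (-j)).2.2 ?_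
  have e1 : h ^ (6 * -j - 2) = (h ^ 2 * (h ^ 6) ^ j)⁻¹ := by
    rw [show 6 * -j - 2 = -(2 + 6 * j) by ring, zpow_neg, zpow_add₀ h_ne, zpow_mul]
    norm_cast
  rw [← pow_mul] at e
  rw [e1, ← mul_right_inj' (mul_ne_zero (pow_ne_zero 2 h_ne) (zpow_ne_zero j (pow_ne_zero 6 h_ne))),
    mul_inv_cancel₀ (mul_ne_zero (pow_ne_zero 2 h_ne) (zpow_ne_zero j (pow_ne_zero 6 h_ne))), ← e]
  ring

theorem gaugeM_succ (h_ne : h ≠ 0) (hx : x ≠ 0) (hθ : thetaG h x ≠ 0) (N : ℤ) :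
    gaugeM h x (N + 1) = gaugeM h x N * gaugeMu h x N := by
  have hQ : h ^ 2 ≠ 0 := pow_ne_zero _ h_ne
  have e1 : (N + 1) * (N + 1 - 1) / 2 = N * (N - 1) / 2 + N := by
    rw [show (N + 1) * (N + 1 - 1) = N * (N - 1) + N * 2 by ring,
      Int.add_mul_ediv_right _ _ (by norm_num)]
  have e2 : (N + 1) * (N + 1 - 1) * (N + 1) = N * (N - 1) * N + (3 * N ^ 2 + N) := by ring
  have e3 : 2 * (N + 1) * (N + 1 - 1) = 2 * N * (N - 1) + 4 * N := by ring
  rw [gaugeM, gaugeM, gaugeMu, e1, e2, e3, zpow_add₀ (by norm_num), zpow_add₀ hQ, zpow_add₀ hx,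
    zpow_add₀ hθ, zpow_one]
  field_simp

theorem gaugeMu_succ (h_ne : h ≠ 0) (hx : x ≠ 0) (N : ℤ) :
    gaugeMu h x (N + 1) = gaugeMu h x N * -(h ^ 8 * ((h ^ 2) ^ N) ^ 6 * x ^ 4) := by
  have hQ : h ^ 2 ≠ 0 := pow_ne_zero _ h_ne
  have e2 : 3 * (N + 1) ^ 2 + (N + 1) = 3 * N ^ 2 + N + (N * (6 : ℕ) + (4 : ℕ)) := by
    push_cast; ring
  have e3 : 4 * (N + 1) = 4 * N + (4 : ℕ) := by push_cast; ring
  rw [gaugeMu, gaugeMu, e2, e3, zpow_add₀ (by norm_num), zpow_add₀ hQ (3 * N ^ 2 + N) (_ + _),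
    zpow_add₀ hQ (N * _), zpow_add₀ hx, zpow_mul (h ^ 2) N, zpow_natCast, zpow_natCast, zpow_natCast,
    zpow_one]
  ring

theorem gaugeMu_shift (h_ne : h ≠ 0) (h_lt : ‖h‖ < 1) (hx : x ≠ 0) (hθ : thetaG h x ≠ 0) (N : ℤ) :
    gaugeMu h (h * x) N = -(gaugeMu h x N * (((h ^ 2) ^ N) ^ 2 * h ^ 2 * x ^ 6)) := by
  have e1 := thetaG_mul h_ne h_lt hx
  have hθ' : thetaG h (h * x) ≠ 0 := by
    intro h0; rw [h0, mul_zero] at e1; exact hθ (neg_eq_zero.1 e1.symm)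
  have e2 : h ^ (4 * N) = ((h ^ 2) ^ N) ^ 2 := by
    rw [← zpow_natCast, ← zpow_natCast, ← zpow_mul, ← zpow_mul]; congr 1; push_cast; ring
  rw [gaugeMu, gaugeMu, mul_zpow, e2, div_eq_iff hθ']
  generalize (h ^ 2) ^ (3 * N ^ 2 + N) = c
  generalize (h ^ 2) ^ N = P
  generalize (-1 : ℂ) ^ N = s
  generalize x ^ (4 * N) = t
  have e3 : (thetaG h x)⁻¹ * (h ^ 2 * x ^ 6 * thetaG h (h * x)) = -1 := by
    rw [e1]; field_simp
  rw [div_eq_mul_inv]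
  linear_combination s * c * t * P ^ 2 * e3

/-- The powers of $x$ agree because $x\cdot h^3x=hx\cdot h^2x$, so only the theta functions
contribute. The rule is needed for the $R_1$ equations, where products over the sites $k-2,k+1$ meet
products over $k-1,k$. -/
theorem gaugeM_quadratic (h_ne : h ≠ 0) (h_lt : ‖h‖ < 1) (hx : x ≠ 0) (N : ℤ) :
    gaugeM h x N * gaugeM h (h ^ 3 * x) N
      = ((h ^ 2) ^ N) ^ 6 * (gaugeM h (h * x) N * gaugeM h (h ^ 2 * x) N) := by
  have e1 := thetaG_mul h_ne h_lt hx
  have e2 := thetaG_mul h_ne h_lt (mul_ne_zero (pow_ne_zero 2 h_ne) hx)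
  have e3 : h ^ 12 * (thetaG h x * thetaG h (h ^ 3 * x))
      = thetaG h (h * x) * thetaG h (h ^ 2 * x) := by
    have : x ^ 6 * h ^ 2 ≠ 0 := by positivity
    rw [show h * (h ^ 2 * x) = h ^ 3 * x by ring] at e2
    apply mul_left_cancel₀ this
    linear_combination -thetaG h (h ^ 2 * x) * e1 + thetaG h x * e2
  have e4 : (h ^ 12) ^ N = ((h ^ 2) ^ N) ^ 6 := by
    rw [← zpow_natCast, ← zpow_natCast, ← zpow_natCast, ← zpow_mul, ← zpow_mul, ← zpow_mul]
    congr 1; push_cast; ring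
  have e5 : ((h ^ 2) ^ N) ^ 6 * (thetaG h x ^ N * thetaG h (h ^ 3 * x) ^ N)
      = thetaG h (h * x) ^ N * thetaG h (h ^ 2 * x) ^ N := by
    rw [← e4, ← mul_zpow, ← mul_zpow, e3, mul_zpow]
  have e6 : ∀ E : ℤ, x ^ E * (h ^ 3 * x) ^ E = (h * x) ^ E * (h ^ 2 * x) ^ E := by
    intro E; rw [← mul_zpow, ← mul_zpow]; congr 1; ring
  have hP : ((h ^ 2) ^ N) ^ 6 ≠ 0 := pow_ne_zero _ (zpow_ne_zero _ (pow_ne_zero _ h_ne))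
  rw [gaugeM, gaugeM, gaugeM, gaugeM, div_mul_div_comm, div_mul_div_comm, ← e5, mul_div_assoc',
    mul_div_mul_left _ _ hP]
  congr 1
  linear_combination ((-1) ^ (N * (N - 1) / 2) * (h ^ 2) ^ (N * (N - 1) * N)) ^ 2
    * e6 (2 * N * (N - 1))

/-- Gamma factors whose arguments differ by $Q$ have a theta function as quotient. The six resulting
theta functions pair off into arguments differing by $Q$ or $Q^2$, so that only a monomial remains.
-/
theorem gammaG_quadratic (h_ne : h ≠ 0) (h_lt : ‖h‖ < 1) (hg : IsGeneric h y) :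
    (h ^ 2 * y) ^ 3 * (gammaG h y * gammaG h (h ^ 3 * y))
      = -(gammaG h (h * y) * gammaG h (h ^ 2 * y)) := by
  have hQ : h ^ 2 ≠ 0 := pow_ne_zero _ h_ne
  have hQ1 : ‖h ^ 2‖ < 1 := norm_pow_lt_one h_lt (by norm_num)
  have hy := hg.1
  have hi : ∀ i : ℕ, (h ^ 2) ^ i = h ^ (2 * (i : ℤ)) := fun i => by
    rw [zpow_mul]; norm_cast
  have c1 : ∀ m : ℤ, ∀ i : ℕ, h ^ (2 * m + 1) * y ^ 2 * (h ^ 2) ^ i ≠ 1 := by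
    intro m i e
    apply (hg.2 (-m - i - 1)).2.1
    rw [hi] at e
    rw [show 2 * (-m - i - 1) + 1 = -(2 * m + 1 + 2 * (i : ℤ)) by ring, zpow_neg, zpow_add₀ h_ne]
    refine eq_inv_of_mul_eq_one_left ?_
    rw [← e]; ring
  -- With $a=(h^3y)^{-1}$ every gamma argument is $h^my^2$ or $h^ma$ with $m\ge0$.
  obtain ⟨a, ha⟩ : ∃ a, h ^ 3 * y * a = 1 :=
    ⟨(h ^ 3 * y)⁻¹, mul_inv_cancel₀ (mul_ne_zero (pow_ne_zero _ h_ne) hy)⟩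
  have ha0 : a ≠ 0 := right_ne_zero_of_mul_eq_one ha
  have c2 : ∀ m : ℕ, ∀ i : ℕ, h ^ m * a * (h ^ 2) ^ i ≠ 1 := by
    intro m i e
    apply (hg.2 (m + 2 * i - 3)).1
    rw [hi] at e
    rw [zpow_sub₀ h_ne, zpow_add₀ h_ne, eq_div_iff (zpow_ne_zero _ h_ne)]
    norm_cast at *
    apply mul_right_cancel₀ ha0
    linear_combination ha - e
  have hm : ∀ m : ℕ, h ^ m * a ≠ 0 := fun m => mul_ne_zero (pow_ne_zero _ h_ne) ha0
  have hm' : ∀ m : ℕ, h ^ m * y ^ 2 ≠ 0 := fun m =>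
    mul_ne_zero (pow_ne_zero _ h_ne) (pow_ne_zero _ hy)
  have hΓ : ∀ m : ℕ, ellGamma (h ^ (m + 2) * a) (h ^ 2) (h ^ 2)
      = Theta (h ^ m * a) (h ^ 2) * ellGamma (h ^ m * a) (h ^ 2) (h ^ 2) := fun m => by
    rw [← ellGamma_mul hQ hQ1 (hm m) (c2 m)]; congr 1; ring
  have hΓ' : ∀ m : ℕ, ellGamma (h ^ (2 * m + 3) * y ^ 2) (h ^ 2) (h ^ 2)
      = Theta (h ^ (2 * m + 1) * y ^ 2) (h ^ 2)
        * ellGamma (h ^ (2 * m + 1) * y ^ 2) (h ^ 2) (h ^ 2) := fun m => by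
    rw [← ellGamma_mul hQ hQ1 (hm' _) (by exact_mod_cast c1 m)]; congr 1; ring
  have hΘ : ∀ b, b ≠ 0 → b * Theta (h ^ 2 * b) (h ^ 2) = -Theta b (h ^ 2) := fun b hb => by
    rw [Theta_mul hQ hQ1 hb]; field_simp
  have t1 := hΘ _ (hm' 3)
  have t2 := hΘ _ (hm' 5)
  have t3 := hΘ _ (hm 0)
  have t4 := hΘ _ (hm 2)
  have t5 := hΘ _ (hm 1)
  rw [show h ^ 2 * (h ^ 3 * y ^ 2) = h ^ 5 * y ^ 2 by ring] at t1
  rw [show h ^ 2 * (h ^ 5 * y ^ 2) = h ^ 7 * y ^ 2 by ring] at t2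
  rw [show h ^ 2 * (h ^ 0 * a) = h ^ 2 * a by ring] at t3
  rw [show h ^ 2 * (h ^ 2 * a) = h ^ 4 * a by ring] at t4
  rw [show h ^ 2 * (h ^ 1 * a) = h ^ 3 * a by ring] at t5
  have r1 : Theta (h ^ 3 * y ^ 2) (h ^ 2) = h ^ 8 * y ^ 4 * Theta (h ^ 7 * y ^ 2) (h ^ 2) := by
    linear_combination t1 - h ^ 3 * y ^ 2 * t2
  have r2 : Theta (h ^ 0 * a) (h ^ 2) = h ^ 2 * a ^ 2 * Theta (h ^ 4 * a) (h ^ 2) := by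
    linear_combination t3 - a * t4
  have r3 : Theta (h ^ 1 * a) (h ^ 2) = -(h * a * Theta (h ^ 3 * a) (h ^ 2)) := by
    linear_combination t5
  have i0 : y⁻¹ = h ^ 3 * a := inv_eq_of_mul_eq_one_right (by linear_combination ha)
  have i1 : (h * y)⁻¹ = h ^ 2 * a := inv_eq_of_mul_eq_one_right (by linear_combination ha)
  have i2 : (h ^ 2 * y)⁻¹ = h ^ 1 * a := inv_eq_of_mul_eq_one_right (by linear_combination ha)
  have i3 : (h ^ 3 * y)⁻¹ = h ^ 0 * a := inv_eq_of_mul_eq_one_right (by linear_combination ha)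
  have n9 := hΓ' 3
  have n5 := hΓ' 1
  have n3 := hΓ 1
  have n2 := hΓ 0
  have n6 := hΓ 4
  have n5' := hΓ 3
  norm_num only at n9 n5 n3 n2 n6 n5'
  rw [gammaG, gammaG, gammaG, gammaG, i0, i1, i2, i3,
    show h ^ 3 * (h ^ 3 * y) ^ 2 = h ^ 9 * y ^ 2 by ring,
    show h ^ 3 * (h * y) ^ 2 = h ^ 5 * y ^ 2 by ring,
    show h ^ 3 * (h ^ 2 * y) ^ 2 = h ^ 7 * y ^ 2 by ring,
    show h ^ 3 * (h ^ 3 * a) = h ^ 6 * a by ring,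
    show h ^ 3 * (h ^ 2 * a) = h ^ 5 * a by ring,
    show h ^ 3 * (h ^ 1 * a) = h ^ 4 * a by ring,
    show h ^ 3 * (h ^ 0 * a) = h ^ 3 * a by ring]
  rw [n9, n5, n6, n5', n2, r1, r2]
  have n0 := n3
  rw [r3] at n0
  generalize ellGamma (h ^ 3 * a) _ _ = E at n0 ⊢
  generalize ellGamma (h ^ 1 * a) _ _ = Γ1 at n0 ⊢
  generalize ellGamma (h ^ 0 * a) _ _ = Γ0
  generalize ellGamma (h ^ 4 * a) _ _ = Γ4
  generalize ellGamma (h ^ 3 * y ^ 2) _ _ = Γ3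
  generalize ellGamma (h ^ 7 * y ^ 2) _ _ = Γ7
  generalize Theta (h ^ 7 * y ^ 2) _ = Θ7
  generalize Theta (h ^ 4 * a) _ = Θ4
  generalize Theta (h ^ 3 * a) _ = Θ3 at n0 ⊢
  linear_combination h ^ 6 * y ^ 3 * (Γ3 * Γ4 * Θ4 * Θ7 * Γ7 * Γ0 * E) * n0
    + h ^ 7 * y ^ 3 * a * (Γ3 * Γ4 * Θ4 * Θ7 * Γ7 * Γ0 * E * Θ3 * Γ1) * ha

end Gauge

/-! ### The action at a site as polynomial equations. -/

section Lattice

variable {h α₀ : ℂ}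

/-- Passes between the defining relations and their forms without denominators; $c$ is the monomial
by which the two differ. -/
theorem eq_iff_of_mul_sub {c L R L' R' : ℂ} (hc : c ≠ 0) (H : c * (L - R) = L' - R') :
    L = R ↔ L' = R' := by
  rw [← sub_eq_zero, ← sub_eq_zero (a := L'), ← H]
  simp [hc]

/-- The equations expressing the action of `R_1` at a site, with `x = Q^{k/2} α₀`. -/
def R1Eqs (h : ℂ) (τ : ℤ → ℤ → ℂ → ℂ) (k N : ℤ) (α₀ x P : ℂ) : Prop :=
  h ^ 2 * P ^ 2 * x ^ 3 * (τ (k - 2) (N + 1) α₀ * τ (k + 1) N α₀)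
      = x ^ 6 * (τ k N α₀ * τ (k - 1) (N + 1) α₀)
        + h ^ 4 * P ^ 4 * (τ k (N + 1) α₀ * τ (k - 1) N α₀) ∧
  h ^ 2 * P ^ 2 * x ^ 3 * (τ (k - 2) N α₀ * τ (k + 1) (N + 1) α₀)
      = h ^ 4 * P ^ 4 * x ^ 6 * (τ k (N + 1) α₀ * τ (k - 1) N α₀)
        + τ k N α₀ * τ (k - 1) (N + 1) α₀

theorem R1Rel_site (h_ne : h ≠ 0) (hα : α₀ ≠ 0) {τ : ℤ → ℤ → ℂ → ℂ} {k N : ℤ}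
    (H : R1Eqs h τ k N α₀ (h ^ k * α₀) ((h ^ 2) ^ N)) :
    R1Rel (h ^ 2) (site h τ k N α₀) (site h τ (k + 1) N α₀) := by
  have hP : (h ^ 2) ^ N ≠ 0 := zpow_ne_zero _ (pow_ne_zero _ h_ne)
  have hx : h ^ k * α₀ ≠ 0 := mul_ne_zero (zpow_ne_zero _ h_ne) hα
  have e1 : h ^ (k + 1) * α₀ = h * (h ^ k * α₀) := by rw [zpow_add_one₀ h_ne]; ring
  obtain ⟨H1, H2⟩ := H
  refine ⟨fun j => ?_, rfl, fun j hj => ?_, ?_, ?_⟩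
  · fin_cases j <;> simp [site, piMap, cartan, e1] <;> field_simp
  · fin_cases j
    · simp [site, piMap, show k + 1 - 2 = k - 1 by ring]
    · simp at hj
    · simp [site, piMap]
  · simp [site, piMap, TauPoint.u, TauPoint.uSqrt]
    generalize h ^ k * α₀ = x at *
    generalize (h ^ 2) ^ N = P at *
    refine (eq_iff_of_mul_sub (c := h ^ 4 * P ^ 4) (by positivity) ?_).2 H1
    field_simp
    try ring
  · simp [site, piMap, TauPoint.v, TauPoint.vSqrt]
    linear_combination H2

theorem R1InvRel_site (h_ne : h ≠ 0) (hα : α₀ ≠ 0) {τ : ℤ → ℤ → ℂ → ℂ} {k N : ℤ}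
    (H : R1Eqs h τ (k - 1) N α₀ (h ^ (k - 1) * α₀) ((h ^ 2) ^ N)) :
    R1InvRel (h ^ 2) (site h τ k N α₀) (site h τ (k - 1) N α₀) := by
  have hP : (h ^ 2) ^ N ≠ 0 := zpow_ne_zero _ (pow_ne_zero _ h_ne)
  have hx : h ^ (k - 1) * α₀ ≠ 0 := mul_ne_zero (zpow_ne_zero _ h_ne) hα
  have e1 : h ^ k * α₀ = h * (h ^ (k - 1) * α₀) := by
    rw [← mul_assoc, ← zpow_one_add₀ h_ne]; congr 2; ring
  obtain ⟨H1, H2⟩ := H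
  have e3 : k - 1 - 1 = k - 2 := by ring
  rw [e3, sub_add_cancel] at H1 H2
  have e4 : h * (α₀⁻¹ * (h ^ k)⁻¹) = (h ^ (k - 1) * α₀)⁻¹ := by
    rw [← mul_inv, mul_comm α₀, e1, mul_inv, mul_inv_cancel_left₀ h_ne]
  -- Since $\pi^3=1$, the point before the final $\pi$ must be $\pi^2$ of the target. As $s_1$
  -- inverts $\alpha_1$, the two equations of $R_1$ exchange roles here.
  refine ⟨piMap (piMap (site h τ (k - 1) N α₀)), ⟨fun j => ?_, rfl, fun j hj => ?_, ?_, ?_⟩, ?_⟩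
  · fin_cases j <;> simp [site, piMap, cartan, e1] <;> field_simp <;> simp
  · fin_cases j
    · simp [site, piMap, e3]
    · simp at hj
    · simp [site, piMap]
  · simp [site, piMap, TauPoint.u, TauPoint.uSqrt]
    rw [e4]
    generalize h ^ (k - 1) * α₀ = x at *
    generalize (h ^ 2) ^ N = P at *
    refine (eq_iff_of_mul_sub (c := h ^ 4 * P ^ 4 * x ^ 6) (by positivity) ?_).2 H2
    field_simp
    try ring
  · simp [site, piMap, TauPoint.v, TauPoint.vSqrt]
    rw [e4]
    generalize h ^ (k - 1) * α₀ = x at *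
    generalize (h ^ 2) ^ N = P at *
    refine (eq_iff_of_mul_sub (c := x ^ 6) (by positivity) ?_).2 H1
    field_simp
    try ring
  · have hi : ∀ i : Fin 3, i + 1 + 1 + 1 = i := by decide
    ext j <;> simp [piMap, hi]

/-- The equations expressing the action of `T_4` at a site, with `x = Q^{k/2} α₀`. -/
def T4Eqs (h : ℂ) (τ : ℤ → ℤ → ℂ → ℂ) (k N : ℤ) (α₀ x P : ℂ) : Prop :=
  h ^ 10 * P ^ 4 * x ^ 2 * (τ k N α₀ * τ (k - 1) N α₀ * τ (k - 2) (N + 2) α₀)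
      = h ^ 10 * P ^ 4 * (τ (k - 2) N α₀ * τ k (N + 1) α₀ * τ (k - 1) (N + 1) α₀)
        + h ^ 20 * P ^ 8 * (τ (k - 2) (N + 1) α₀ * τ k N α₀ * τ (k - 1) (N + 1) α₀)
        + x ^ 6 * (τ (k - 2) (N + 1) α₀ * τ k (N + 1) α₀ * τ (k - 1) N α₀) ∧
  h ^ 8 * P ^ 4 * x ^ 2 * (τ (k - 1) N α₀ * τ (k - 2) N α₀ * τ k (N + 2) α₀)
      = h ^ 10 * P ^ 4 * (τ k N α₀ * τ (k - 1) (N + 1) α₀ * τ (k - 2) (N + 1) α₀)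
        + h ^ 14 * P ^ 8 * x ^ 6 * (τ k (N + 1) α₀ * τ (k - 1) N α₀ * τ (k - 2) (N + 1) α₀)
        + τ k (N + 1) α₀ * τ (k - 1) (N + 1) α₀ * τ (k - 2) N α₀ ∧
  h ^ 6 * P ^ 4 * x ^ 2 * (τ (k - 2) N α₀ * τ k N α₀ * τ (k - 1) (N + 2) α₀)
      = h ^ 4 * P ^ 4 * x ^ 6 * (τ (k - 1) N α₀ * τ (k - 2) (N + 1) α₀ * τ k (N + 1) α₀)
        + h ^ 14 * P ^ 8 * (τ (k - 1) (N + 1) α₀ * τ (k - 2) N α₀ * τ k (N + 1) α₀)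
        + τ (k - 1) (N + 1) α₀ * τ (k - 2) (N + 1) α₀ * τ k N α₀

theorem T4Rel_site_iff (h_ne : h ≠ 0) (hα : α₀ ≠ 0) {τ : ℤ → ℤ → ℂ → ℂ} {k N : ℤ} :
    T4Rel (h ^ 2) (site h τ k N α₀) (site h τ k (N + 1) α₀) ↔
      T4Eqs h τ k N α₀ (h ^ k * α₀) ((h ^ 2) ^ N) := by
  have hP : (h ^ 2) ^ N ≠ 0 := zpow_ne_zero _ (pow_ne_zero _ h_ne)
  have hx : h ^ k * α₀ ≠ 0 := mul_ne_zero (zpow_ne_zero _ h_ne) hα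
  have e1 : (h ^ 2) ^ (N + 1) = (h ^ 2) ^ N * h ^ 2 := zpow_add_one₀ (pow_ne_zero _ h_ne) _
  have e2 : N + 1 + 1 = N + 2 := by ring
  generalize hxd : h ^ k * α₀ = x at *
  generalize hPd : (h ^ 2) ^ N = P at *
  simp only [T4Rel, W0Rel, site, rMap, TauPoint.u, hxd, hPd, e1, e2, Fin.forall_fin_succ]
  simp
  constructor
  · rintro ⟨H0, H1, H2⟩
    refine ⟨(eq_iff_of_mul_sub (c := h ^ 8 * P ^ 4 * x ^ 2) (by positivity) ?_).1 H0,
      (eq_iff_of_mul_sub (c := h ^ 8 * P ^ 4) (by positivity) ?_).1 H1,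
      (eq_iff_of_mul_sub (c := h ^ 4 * P ^ 4 * x ^ 4) (by positivity) ?_).1 H2⟩ <;>
    · field_simp
      try ring
  · rintro ⟨H0, H1, H2⟩
    refine ⟨(eq_iff_of_mul_sub (c := h ^ 8 * P ^ 4 * x ^ 2) (by positivity) ?_).2 H0,
      (eq_iff_of_mul_sub (c := h ^ 8 * P ^ 4) (by positivity) ?_).2 H1,
      (eq_iff_of_mul_sub (c := h ^ 4 * P ^ 4 * x ^ 4) (by positivity) ?_).2 H2⟩ <;>
    · field_simp
      try ring

/-- The equations expressing the action of `T_4⁻¹` at a site, with `x = Q^{k/2} α₀`. -/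
def T4InvEqs (h : ℂ) (τ : ℤ → ℤ → ℂ → ℂ) (k N : ℤ) (α₀ x P : ℂ) : Prop :=
  h ^ 2 * P ^ 4 * x ^ 2 * (τ k (N + 1) α₀ * τ (k - 1) (N + 1) α₀ * τ (k - 2) (N - 1) α₀)
      = h ^ 2 * P ^ 4 * (τ (k - 2) (N + 1) α₀ * τ k N α₀ * τ (k - 1) N α₀)
        + h ^ 4 * (τ (k - 2) N α₀ * τ k (N + 1) α₀ * τ (k - 1) N α₀)
        + P ^ 8 * x ^ 6 * (τ (k - 2) N α₀ * τ k N α₀ * τ (k - 1) (N + 1) α₀) ∧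
  h ^ 2 * P ^ 4 * x ^ 2 * (τ (k - 1) (N + 1) α₀ * τ (k - 2) (N + 1) α₀ * τ k (N - 1) α₀)
      = h ^ 4 * P ^ 4 * (τ k (N + 1) α₀ * τ (k - 1) N α₀ * τ (k - 2) N α₀)
        + x ^ 6 * (τ k N α₀ * τ (k - 1) (N + 1) α₀ * τ (k - 2) N α₀)
        + h ^ 2 * P ^ 8 * (τ k N α₀ * τ (k - 1) N α₀ * τ (k - 2) (N + 1) α₀) ∧
  h ^ 2 * P ^ 4 * x ^ 2 * (τ (k - 2) (N + 1) α₀ * τ k (N + 1) α₀ * τ (k - 1) (N - 1) α₀)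
      = P ^ 4 * x ^ 6 * (τ (k - 1) (N + 1) α₀ * τ (k - 2) N α₀ * τ k N α₀)
        + h ^ 2 * (τ (k - 1) N α₀ * τ (k - 2) (N + 1) α₀ * τ k N α₀)
        + h ^ 4 * P ^ 8 * (τ (k - 1) N α₀ * τ (k - 2) N α₀ * τ k (N + 1) α₀)

theorem T4InvRel_site_iff (h_ne : h ≠ 0) (hα : α₀ ≠ 0) {τ : ℤ → ℤ → ℂ → ℂ} {k N : ℤ} :
    T4InvRel (h ^ 2) (site h τ k N α₀) (site h τ k (N - 1) α₀) ↔
      T4InvEqs h τ k N α₀ (h ^ k * α₀) ((h ^ 2) ^ N) := by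
  have hP : (h ^ 2) ^ N ≠ 0 := zpow_ne_zero _ (pow_ne_zero _ h_ne)
  have hx : h ^ k * α₀ ≠ 0 := mul_ne_zero (zpow_ne_zero _ h_ne) hα
  have e1 : (h ^ 2) ^ (N - 1) = (h ^ 2) ^ N * (h ^ 2)⁻¹ := zpow_sub_one₀ (pow_ne_zero _ h_ne) _
  have e2 : N - 1 + 1 = N := by ring
  have key : T4InvRel (h ^ 2) (site h τ k N α₀) (site h τ k (N - 1) α₀) ↔
      W0Rel (h ^ 2) (site h τ k N α₀) (rMap (h ^ 2) (site h τ k (N - 1) α₀)) := by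
    have hr : ∀ p : TauPoint, rMap (h ^ 2) (rMap (h ^ 2) p) = p := fun p => by
      ext <;> simp [rMap]
      field_simp
    constructor
    · rintro ⟨x, hx, e⟩
      rw [e, hr]; exact hx
    · intro H
      exact ⟨_, H, (hr _).symm⟩
  rw [key]
  generalize hxd : h ^ k * α₀ = x at *
  generalize hPd : (h ^ 2) ^ N = P at *
  simp only [W0Rel, site, rMap, TauPoint.u, hxd, hPd, e1, e2, Fin.forall_fin_succ]
  simp
  constructor
  · rintro ⟨-, H0, H1, H2⟩
    refine ⟨(eq_iff_of_mul_sub (c := P ^ 4 * x ^ 2) (by positivity) ?_).1 H0,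
      (eq_iff_of_mul_sub (c := h ^ 2 * P ^ 4) (by positivity) ?_).1 H1,
      (eq_iff_of_mul_sub (c := P ^ 4 * x ^ 4) (by positivity) ?_).1 H2⟩ <;>
    · field_simp
      try ring
  · rintro ⟨H0, H1, H2⟩
    refine ⟨by field_simp, (eq_iff_of_mul_sub (c := P ^ 4 * x ^ 2) (by positivity) ?_).2 H0,
      (eq_iff_of_mul_sub (c := h ^ 2 * P ^ 4) (by positivity) ?_).2 H1,
      (eq_iff_of_mul_sub (c := P ^ 4 * x ^ 4) (by positivity) ?_).2 H2⟩ <;>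
    · field_simp
      try ring

end Lattice

/-! ### Trilinear identities for the determinants. -/

section Trilinear

variable {h α₀ y : ℂ} {G : ℤ → ℂ}

/-- Replaces the coefficients of the recurrence by powers of $y$, the value of $x$ at the site
$k-2$. -/
theorem threeCoeff_mul_pow (h_ne : h ≠ 0) (hα : α₀ ≠ 0) {k : ℤ} (hy : y = h ^ (k - 2) * α₀)
    (l : ℕ) : threeCoeff h α₀ (k - 2 + l) * (h ^ l * y) ^ 12 = 1 := by
  have e : h ^ (k - 2 + l) * α₀ = h ^ l * y := by
    rw [zpow_add₀ h_ne, hy, zpow_natCast]; ring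
  have : h ^ l * y ≠ 0 := by
    rw [hy]; exact mul_ne_zero (pow_ne_zero _ h_ne) (mul_ne_zero (zpow_ne_zero _ h_ne) hα)
  rw [threeCoeff_eq, e, inv_mul_cancel₀ (pow_ne_zero _ this)]

theorem zpow_twelve (h : ℂ) (N : ℤ) : (h ^ 12) ^ N = ((h ^ 2) ^ N) ^ 6 := by
  rw [← zpow_natCast, ← zpow_natCast, ← zpow_natCast, ← zpow_mul, ← zpow_mul, ← zpow_mul]
  congr 1; push_cast; ring

theorem phiDet_down (h_ne : h ≠ 0) (hα : α₀ ≠ 0) (hG : ThreeTerm h α₀ G) {k N : ℤ}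
    (hy : y = h ^ (k - 2) * α₀) (hN : 0 ≤ N) :
    h ^ 12 * y ^ 12 * (((h ^ 2) ^ N) ^ 6 * (phiDet G k (N + 1) * phiDet G (k - 1) N)
      - phiDet G k N * phiDet G (k - 1) (N + 1))
      + ((h ^ 2) ^ N) ^ 6 * (phiDet G (k - 2) (N + 1) * phiDet G (k + 1) N) = 0 := by
  have h1 := phiDet_bilinear_down h_ne hG k hN
  have h2 := threeCoeff_mul_pow h_ne hα hy 1
  rw [zpow_twelve] at h1
  push_cast at h2
  rw [show k - 2 + 1 = k - 1 by ring] at h2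
  generalize threeCoeff h α₀ (k - 1) = C at *
  generalize (h ^ 2) ^ N = P at *
  linear_combination h ^ 12 * y ^ 12 * h1
    - P ^ 6 * (phiDet G (k - 2) (N + 1) * phiDet G (k + 1) N) * h2

theorem phiDet_up (h_ne : h ≠ 0) (hα : α₀ ≠ 0) (hG : ThreeTerm h α₀ G) {k N : ℤ}
    (hy : y = h ^ (k - 2) * α₀) (hN : 0 ≤ N) :
    h ^ 24 * y ^ 12 * (((h ^ 2) ^ N) ^ 12 * (phiDet G (k + 1) (N + 1) * phiDet G (k - 2) N))
      = h ^ 24 * y ^ 12 * (((h ^ 2) ^ N) ^ 6 * (phiDet G k (N + 1) * phiDet G (k - 1) N))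
        - phiDet G k N * phiDet G (k - 1) (N + 1) := by
  have h1 := phiDet_bilinear_up h_ne hG k hN
  have h2 := threeCoeff_mul_pow h_ne hα hy 2
  rw [zpow_twelve] at h1
  push_cast at h2
  rw [show k - 2 + 2 = k by ring] at h2
  generalize threeCoeff h α₀ k = C at *
  generalize (h ^ 2) ^ N = P at *
  linear_combination h ^ 24 * y ^ 12 * h1
    - (phiDet G k N * phiDet G (k - 1) (N + 1)) * h2

theorem phiDet_toda' (h_ne : h ≠ 0) (hα : α₀ ≠ 0) (hG : ThreeTerm h α₀ G) {k N : ℤ}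
    (hy : y = h ^ (k - 2) * α₀) (hN : -1 ≤ N) :
    h ^ 36 * ((h ^ 2) ^ N) ^ 12 * y ^ 12 * (phiDet G k (N + 2) * phiDet G (k - 1) N)
      = phiDet G k (N + 1) * phiDet G (k - 1) (N + 1)
        - h ^ 24 * ((h ^ 2) ^ N) ^ 12 *
          (phiDet G (k - 2) (N + 1) * phiDet G (k + 1) (N + 1)) := by
  have h1 := phiDet_toda h_ne hG k hN
  have h2 := threeCoeff_mul_pow h_ne hα hy 2
  rw [zpow_twelve] at h1
  push_cast at h2
  rw [show k - 2 + 2 = k by ring] at h2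
  generalize threeCoeff h α₀ k = C at *
  generalize (h ^ 2) ^ N = P at *
  linear_combination h ^ 24 * y ^ 12 * h1
    + (phiDet G k (N + 1) * phiDet G (k - 1) (N + 1)
        - h ^ 24 * P ^ 12 * (phiDet G (k - 2) (N + 1) * phiDet G (k + 1) (N + 1))) * h2

/-- A bilinear identity over the levels $N,N+1,N+2$ produces the term of level $N+2$ but also a
factor at site $k-3$ or $k+1$. Multiplying by one more determinant, `phiDet_down` or `phiDet_up`
removes that factor. -/
theorem phiDet_trilinear (h_ne : h ≠ 0) (hα : α₀ ≠ 0) (hG : ThreeTerm h α₀ G) {k N : ℤ}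
    (hy : y = h ^ (k - 2) * α₀) (hN : 0 ≤ N) {P : ℂ} (hP : P = (h ^ 2) ^ N) :
    P ^ 6 * (phiDet G k N * phiDet G (k - 1) N * phiDet G (k - 2) (N + 2))
        = y ^ 12 * P ^ 6 * (phiDet G (k - 2) N * phiDet G k (N + 1) * phiDet G (k - 1) (N + 1))
          + P ^ 6 * (phiDet G (k - 2) (N + 1) * phiDet G k N * phiDet G (k - 1) (N + 1))
          - y ^ 12 * (phiDet G (k - 2) (N + 1) * phiDet G k (N + 1) * phiDet G (k - 1) N) ∧
      h ^ 36 * P ^ 12 * y ^ 24 * (phiDet G (k - 1) N * phiDet G (k - 2) N * phiDet G k (N + 2))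
        = y ^ 12 * (phiDet G k (N + 1) * phiDet G (k - 1) (N + 1) * phiDet G (k - 2) N)
          - phiDet G (k - 2) (N + 1) *
            (h ^ 24 * y ^ 12 * P ^ 6 * (phiDet G k (N + 1) * phiDet G (k - 1) N)
              - phiDet G k N * phiDet G (k - 1) (N + 1)) ∧
      h ^ 24 * y ^ 12 * P ^ 12 * (phiDet G (k - 2) N * phiDet G k N * phiDet G (k - 1) (N + 2))
        = h ^ 24 * y ^ 12 * P ^ 12
            * (phiDet G (k - 1) (N + 1) * phiDet G k (N + 1) * phiDet G (k - 2) N)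
          - phiDet G (k - 2) (N + 1) *
            (h ^ 24 * y ^ 12 * P ^ 6 * (phiDet G k (N + 1) * phiDet G (k - 1) N)
              - phiDet G k N * phiDet G (k - 1) (N + 1)) := by
  have hy' : h⁻¹ * y = h ^ (k - 1 - 2) * α₀ := by
    rw [hy, ← mul_assoc, ← zpow_neg_one, ← zpow_add₀ h_ne]; congr 2; ring
  have J1 := phiDet_jacobi G (k - 2) (show -1 ≤ N by omega)
  have J2 := phiDet_jacobi G (k - 1) (show -1 ≤ N by omega)
  have J3 := phiDet_toda' h_ne hα hG hy (show -1 ≤ N by omega)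
  have B1 := phiDet_down h_ne hα hG hy' hN
  have B2 := phiDet_up h_ne hα hG hy hN
  have e1 : k - 2 + 1 = k - 1 := by ring
  have e2 : k - 2 + 2 = k := by ring
  have e3 : k - 1 + 1 = k := by ring
  have e4 : k - 1 + 2 = k + 1 := by ring
  have e5 : k - 1 - 1 = k - 2 := by ring
  have e6 : k - 1 - 2 = k - 2 - 1 := by ring
  rw [e1, e2] at J1
  rw [e3, e4, e5] at J2
  have e7 : h ^ 12 * (h⁻¹ * y) ^ 12 = y ^ 12 := by field_simp
  rw [e3, e5, e6, e7] at B1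
  rw [← hP] at J3 B1 B2
  refine ⟨?_, ?_, ?_⟩
  · linear_combination P ^ 6 * phiDet G k N * J1 - phiDet G k (N + 1) * B1
  · linear_combination phiDet G (k - 2) N * y ^ 12 * J3 - phiDet G (k - 2) (N + 1) * B2
  · linear_combination h ^ 24 * y ^ 12 * P ^ 12 * phiDet G (k - 2) N * J2
      - phiDet G (k - 2) (N + 1) * B2

/-- The same elimination downwards: the auxiliary identities are taken between the levels $N+1$ and
$N+2$, which leaves a single factor of level $N$ on the left. -/
theorem phiDet_trilinear_inv (h_ne : h ≠ 0) (hα : α₀ ≠ 0) (hG : ThreeTerm h α₀ G) {k N : ℤ}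
    (hy : y = h ^ (k - 2) * α₀) (hN : -1 ≤ N) {P : ℂ} (hP : P = (h ^ 2) ^ N) :
    h ^ 36 * P ^ 12 * y ^ 24
          * (phiDet G k (N + 2) * phiDet G (k - 1) (N + 2) * phiDet G (k - 2) N)
        = h ^ 12 * y ^ 12 * (phiDet G (k - 1) (N + 1) * phiDet G (k - 2) (N + 1)
            * phiDet G k (N + 2))
          - phiDet G k (N + 1) *
            (h ^ 24 * y ^ 12 * P ^ 6 * (phiDet G (k - 1) (N + 2) * phiDet G (k - 2) (N + 1))
              - phiDet G (k - 1) (N + 1) * phiDet G (k - 2) (N + 2)) ∧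
      P ^ 6 * (phiDet G (k - 1) (N + 2) * phiDet G (k - 2) (N + 2) * phiDet G k N)
        = P ^ 6 * (phiDet G (k - 1) (N + 1) * phiDet G k (N + 1) * phiDet G (k - 2) (N + 2))
          - y ^ 12 * phiDet G (k - 2) (N + 1) *
            (phiDet G k (N + 1) * phiDet G (k - 1) (N + 2)
              - h ^ 12 * P ^ 6 * (phiDet G k (N + 2) * phiDet G (k - 1) (N + 1))) ∧
      h ^ 36 * y ^ 12 * P ^ 12
          * (phiDet G (k - 2) (N + 2) * phiDet G k (N + 2) * phiDet G (k - 1) N)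
        = h ^ 36 * y ^ 12 * P ^ 12
            * (phiDet G (k - 2) (N + 1) * phiDet G (k - 1) (N + 1) * phiDet G k (N + 2))
          - phiDet G k (N + 1) *
            (h ^ 24 * y ^ 12 * P ^ 6 * (phiDet G (k - 1) (N + 2) * phiDet G (k - 2) (N + 1))
              - phiDet G (k - 1) (N + 1) * phiDet G (k - 2) (N + 2)) := by
  have hy' : h⁻¹ * y = h ^ (k - 1 - 2) * α₀ := by
    rw [hy, ← mul_assoc, ← zpow_neg_one, ← zpow_add₀ h_ne]; congr 2; ring
  have J1 := phiDet_jacobi G (k - 2) hN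
  have J2 := phiDet_jacobi G (k - 1) hN
  have J3 := phiDet_toda' h_ne hα hG hy' hN
  have B1 := phiDet_down h_ne hα hG hy (show 0 ≤ N + 1 by omega)
  have B2 := phiDet_up h_ne hα hG hy' (show 0 ≤ N + 1 by omega)
  have e0 : N + 1 + 1 = N + 2 := by ring
  have e1 : k - 2 + 1 = k - 1 := by ring
  have e2 : k - 2 + 2 = k := by ring
  have e3 : k - 1 + 1 = k := by ring
  have e4 : k - 1 + 2 = k + 1 := by ring
  have e5 : k - 1 - 1 = k - 2 := by ring
  have e6 : k - 1 - 2 = k - 2 - 1 := by ring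
  have eP : (h ^ 2) ^ (N + 1) = P * h ^ 2 := by rw [hP, zpow_add_one₀ (pow_ne_zero _ h_ne)]
  rw [e1, e2] at J1
  rw [e3, e4, e5] at J2
  have e7 : h ^ 24 * (h⁻¹ * y) ^ 12 = h ^ 12 * y ^ 12 := by field_simp
  have e8 : h ^ 36 * P ^ 12 * (h⁻¹ * y) ^ 12 = h ^ 24 * P ^ 12 * y ^ 12 := by field_simp
  rw [e0, eP] at B1
  rw [e0, eP, e3, e5, e6, e7] at B2
  rw [← hP, e3, e5, e6, e8] at J3
  have hh : h ^ 12 ≠ 0 := pow_ne_zero _ h_ne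
  refine ⟨?_, ?_, ?_⟩
  · linear_combination h ^ 12 * y ^ 12 * phiDet G k (N + 2) * J3 - phiDet G k (N + 1) * B2
  · apply mul_left_cancel₀ hh
    linear_combination h ^ 12 * P ^ 6 * phiDet G (k - 2) (N + 2) * J2
      - phiDet G (k - 2) (N + 1) * B1
  · linear_combination h ^ 36 * y ^ 12 * P ^ 12 * phiDet G k (N + 2) * J1
      - phiDet G k (N + 1) * B2

end Trilinear

/-! ### The explicit functions satisfy the equations of the lattice. -/

section Solution

variable {h α₀ : ℂ} {A B : ℂ → ℂ}

theorem hyperTau_neg (h : ℂ) (A B : ℂ → ℂ) (k : ℤ) {N : ℤ} (hN : N < 0) (α₀ : ℂ) :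
    hyperTau h A B k N α₀ = 0 := by
  rw [hyperTau, phiDet_neg _ _ hN, mul_zero]

theorem hyperTau_succ (h_ne : h ≠ 0) (h_lt : ‖h‖ < 1) (hg : IsGeneric h α₀) (k N : ℤ) :
    hyperTau h A B k (N + 1) α₀ = gaugeM h (h ^ k * α₀) N * gaugeMu h (h ^ k * α₀) N
      * gammaG h (h ^ k * α₀) * phiDet (fun l => entryG h A B l α₀) k (N + 1) := by
  have hg' := hg.shift h_ne k
  rw [hyperTau_eq h_ne, gaugeM_succ h_ne hg'.1 (thetaG_ne_zero h_ne h_lt hg')]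

theorem hyperTau_succ_succ (h_ne : h ≠ 0) (h_lt : ‖h‖ < 1) (hg : IsGeneric h α₀) (k N : ℤ) :
    hyperTau h A B k (N + 2) α₀ = gaugeM h (h ^ k * α₀) N * gaugeMu h (h ^ k * α₀) N ^ 2
      * -(h ^ 8 * ((h ^ 2) ^ N) ^ 6 * (h ^ k * α₀) ^ 4)
      * gammaG h (h ^ k * α₀) * phiDet (fun l => entryG h A B l α₀) k (N + 2) := by
  have hg' := hg.shift h_ne k
  rw [hyperTau_eq h_ne, show N + 2 = N + 1 + 1 by ring,
    gaugeM_succ h_ne hg'.1 (thetaG_ne_zero h_ne h_lt hg'),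
    gaugeM_succ h_ne hg'.1 (thetaG_ne_zero h_ne h_lt hg'), gaugeMu_succ h_ne hg'.1]
  ring

theorem gaugeMu_shift_one (h_ne : h ≠ 0) (h_lt : ‖h‖ < 1) {y : ℂ} (hg : IsGeneric h y) (N : ℤ) :
    gaugeMu h (h * y) N = -(((h ^ 2) ^ N) ^ 2 * h ^ 2 * y ^ 6 * gaugeMu h y N) := by
  rw [gaugeMu_shift h_ne h_lt hg.1 (thetaG_ne_zero h_ne h_lt hg)]; ring

theorem gaugeMu_shift_two (h_ne : h ≠ 0) (h_lt : ‖h‖ < 1) {y : ℂ} (hg : IsGeneric h y) (N : ℤ) :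
    gaugeMu h (h ^ 2 * y) N = ((h ^ 2) ^ N) ^ 4 * h ^ 10 * y ^ 12 * gaugeMu h y N := by
  have hg' : IsGeneric h (h * y) := by simpa using hg.shift h_ne 1
  rw [show h ^ 2 * y = h * (h * y) by ring, gaugeMu_shift_one h_ne h_lt hg',
    gaugeMu_shift_one h_ne h_lt hg]
  ring

theorem gaugeMu_shift_three (h_ne : h ≠ 0) (h_lt : ‖h‖ < 1) {y : ℂ} (hg : IsGeneric h y) (N : ℤ) :
    gaugeMu h (h ^ 3 * y) N = -(((h ^ 2) ^ N) ^ 6 * h ^ 24 * y ^ 18 * gaugeMu h y N) := by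
  have hg' : IsGeneric h (h * y) := by simpa using hg.shift h_ne 1
  rw [show h ^ 3 * y = h ^ 2 * (h * y) by ring, gaugeMu_shift_two h_ne h_lt hg',
    gaugeMu_shift_one h_ne h_lt hg]
  ring

theorem R1Eqs_hyperTau (h_ne : h ≠ 0) (h_lt : ‖h‖ < 1) (hA : IsPeriodic h A) (hB : IsPeriodic h B)
    (hg : IsGeneric h α₀) (k N : ℤ) :
    R1Eqs h (hyperTau h A B) k N α₀ (h ^ k * α₀) ((h ^ 2) ^ N) := by
  rcases lt_or_ge N 0 with hN | hN
  -- Every monomial contains a factor of level $N$, so for negative $N$ both sides vanish.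
  · simp [R1Eqs, hyperTau_neg _ _ _ _ hN]
  have hG := threeTerm_entryG h_ne h_lt hA hB hg.1
  have hy := hg.shift h_ne (k - 2)
  have e1 : h ^ (k - 1) * α₀ = h * (h ^ (k - 2) * α₀) := by
    rw [← mul_assoc, ← zpow_one_add₀ h_ne]; congr 2; ring
  have e2 : h ^ k * α₀ = h ^ 2 * (h ^ (k - 2) * α₀) := by
    rw [← mul_assoc, ← zpow_natCast, ← zpow_add₀ h_ne]; congr 2; push_cast; ring
  have e3 : h ^ (k + 1) * α₀ = h ^ 3 * (h ^ (k - 2) * α₀) := by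
    rw [← mul_assoc, ← zpow_natCast, ← zpow_add₀ h_ne]; congr 2; push_cast; ring
  have d := phiDet_down h_ne hg.1 hG (k := k) rfl hN
  have u := phiDet_up h_ne hg.1 hG (k := k) rfl hN
  simp only [R1Eqs, hyperTau_succ h_ne h_lt hg, hyperTau_eq h_ne _ _ _ N, e1, e2, e3,
    gaugeMu_shift_one h_ne h_lt hy, gaugeMu_shift_two h_ne h_lt hy,
    gaugeMu_shift_three h_ne h_lt hy]
  have q1 := gaugeM_quadratic h_ne h_lt hy.1 N
  have q2 := gammaG_quadratic h_ne h_lt hy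
  generalize h ^ (k - 2) * α₀ = y at *
  generalize (h ^ 2) ^ N = P at *
  generalize gaugeM h y N = m0 at *
  generalize gaugeM h (h * y) N = m1 at *
  generalize gaugeM h (h ^ 2 * y) N = m2 at *
  generalize gaugeM h (h ^ 3 * y) N = m3 at *
  generalize gammaG h y = g0 at *
  generalize gammaG h (h * y) = g1 at *
  generalize gammaG h (h ^ 2 * y) = g2 at *
  generalize gammaG h (h ^ 3 * y) = g3 at *
  generalize gaugeMu h y N = μ at *
  -- The only rule needed to compare the prefactors over the outer sites with those over the inner
  -- ones. With it, the two equations become `phiDet_down` and `phiDet_up`.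
  have q3 : (h ^ 2 * y) ^ 3 * (m0 * g0 * (m3 * g3)) = -(P ^ 6 * (m1 * g1 * (m2 * g2))) := by
    linear_combination (h ^ 2 * y) ^ 3 * g0 * g3 * q1 + P ^ 6 * m1 * m2 * q2
  clear q1 q2
  generalize phiDet _ _ _ = F1 at *
  generalize phiDet _ _ _ = F2 at *
  generalize phiDet _ _ _ = F3 at *
  generalize phiDet _ _ _ = F4 at *
  generalize phiDet _ _ _ = F5 at *
  generalize phiDet _ _ _ = F6 at *
  generalize phiDet _ (k + 1) N = F7 at *
  generalize phiDet _ (k - 2) N = F8 at *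
  refine ⟨?_, ?_⟩
  · linear_combination h ^ 2 * P ^ 2 * μ * F5 * F7 * q3
      - h ^ 2 * P ^ 2 * μ * (m1 * g1 * (m2 * g2)) * d
  · linear_combination -(h ^ 26 * P ^ 8 * y ^ 18 * μ * F8 * F6) * q3
      + h ^ 2 * P ^ 2 * y ^ 6 * μ * (m1 * g1 * (m2 * g2)) * u

/-- Each monomial contains the sites $k-2,k-1,k$ exactly once, so the gamma factors and the level
$N$ prefactors form a common factor. Only the ratios `gaugeMu` distinguish the terms. -/
theorem T4Eqs_hyperTau (h_ne : h ≠ 0) (h_lt : ‖h‖ < 1) (hA : IsPeriodic h A) (hB : IsPeriodic h B)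
    (hg : IsGeneric h α₀) (k N : ℤ) :
    T4Eqs h (hyperTau h A B) k N α₀ (h ^ k * α₀) ((h ^ 2) ^ N) := by
  rcases lt_or_ge N 0 with hN | hN
  · simp [T4Eqs, hyperTau_neg _ _ _ _ hN]
  have hG := threeTerm_entryG h_ne h_lt hA hB hg.1
  have hy := hg.shift h_ne (k - 2)
  have e1 : h ^ (k - 1) * α₀ = h * (h ^ (k - 2) * α₀) := by
    rw [← mul_assoc, ← zpow_one_add₀ h_ne]; congr 2; ring
  have e2 : h ^ k * α₀ = h ^ 2 * (h ^ (k - 2) * α₀) := by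
    rw [← mul_assoc, ← zpow_natCast, ← zpow_add₀ h_ne]; congr 2; push_cast; ring
  obtain ⟨t0, t1, t2⟩ := phiDet_trilinear h_ne hg.1 hG (k := k) rfl hN rfl
  simp only [T4Eqs, hyperTau_succ h_ne h_lt hg, hyperTau_succ_succ h_ne h_lt hg,
    hyperTau_eq h_ne _ _ _ N, e1, e2,
    gaugeMu_shift_one h_ne h_lt hy, gaugeMu_shift_two h_ne h_lt hy]
  generalize h ^ (k - 2) * α₀ = y at *
  generalize (h ^ 2) ^ N = P at *
  generalize gaugeM h y N = m0 at *
  generalize gaugeM h (h * y) N = m1 at *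
  generalize gaugeM h (h ^ 2 * y) N = m2 at *
  generalize gammaG h y = g0 at *
  generalize gammaG h (h * y) = g1 at *
  generalize gammaG h (h ^ 2 * y) = g2 at *
  generalize gaugeMu h y N = μ at *
  refine ⟨?_, ?_, ?_⟩
  · linear_combination -(h ^ 22 * P ^ 4 * y ^ 6 * μ ^ 2 * (m0 * m1 * m2 * g0 * g1 * g2)) * t0
  · linear_combination -(h ^ 12 * P ^ 6 * y ^ 6 * μ ^ 2 * (m0 * m1 * m2 * g0 * g1 * g2)) * t1
  · linear_combination -(h ^ 2 * P ^ 2 * y ^ 6 * μ ^ 2 * (m0 * m1 * m2 * g0 * g1 * g2)) * t2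

theorem T4InvEqs_hyperTau (h_ne : h ≠ 0) (h_lt : ‖h‖ < 1) (hA : IsPeriodic h A)
    (hB : IsPeriodic h B) (hg : IsGeneric h α₀) (k N : ℤ) :
    T4InvEqs h (hyperTau h A B) k N α₀ (h ^ k * α₀) ((h ^ 2) ^ N) := by
  rcases lt_or_ge N 0 with hN | hN
  · simp [T4InvEqs, hyperTau_neg _ _ _ _ hN, hyperTau_neg _ _ _ _ (show N - 1 < 0 by omega)]
  -- The lowest level becomes the base level, possibly $-1$.
  obtain ⟨N, rfl⟩ : ∃ M, N = M + 1 := ⟨N - 1, by ring⟩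
  have hG := threeTerm_entryG h_ne h_lt hA hB hg.1
  have hy := hg.shift h_ne (k - 2)
  have e1 : h ^ (k - 1) * α₀ = h * (h ^ (k - 2) * α₀) := by
    rw [← mul_assoc, ← zpow_one_add₀ h_ne]; congr 2; ring
  have e2 : h ^ k * α₀ = h ^ 2 * (h ^ (k - 2) * α₀) := by
    rw [← mul_assoc, ← zpow_natCast, ← zpow_add₀ h_ne]; congr 2; push_cast; ring
  have e3 : (h ^ 2) ^ (N + 1) = (h ^ 2) ^ N * h ^ 2 := zpow_add_one₀ (pow_ne_zero _ h_ne) _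
  obtain ⟨t0, t1, t2⟩ := phiDet_trilinear_inv h_ne hg.1 hG (k := k) rfl
    (show -1 ≤ N by omega) rfl
  rw [T4InvEqs, add_sub_cancel_right, show N + 1 + 1 = N + 2 by ring]
  simp only [hyperTau_succ h_ne h_lt hg, hyperTau_succ_succ h_ne h_lt hg,
    hyperTau_eq h_ne _ _ _ N, e1, e2, e3,
    gaugeMu_shift_one h_ne h_lt hy, gaugeMu_shift_two h_ne h_lt hy]
  generalize h ^ (k - 2) * α₀ = y at *
  generalize (h ^ 2) ^ N = P at *
  generalize gaugeM h y N = m0 at *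
  generalize gaugeM h (h * y) N = m1 at *
  generalize gaugeM h (h ^ 2 * y) N = m2 at *
  generalize gammaG h y = g0 at *
  generalize gammaG h (h * y) = g1 at *
  generalize gammaG h (h ^ 2 * y) = g2 at *
  generalize gaugeMu h y N = μ at *
  refine ⟨?_, ?_, ?_⟩
  · linear_combination h ^ 30 * P ^ 16 * y ^ 22 * μ ^ 4 * (m0 * m1 * m2 * g0 * g1 * g2) * t0
  · linear_combination h ^ 38 * P ^ 14 * y ^ 22 * μ ^ 4 * (m0 * m1 * m2 * g0 * g1 * g2) * t1
  · linear_combination h ^ 22 * P ^ 12 * y ^ 22 * μ ^ 4 * (m0 * m1 * m2 * g0 * g1 * g2) * t2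

end Solution

/-! ### Existence, and reconstruction of $A$ and $B$. -/

section Hypergeometric

variable {h α₀ : ℂ} {A B : ℂ → ℂ}

theorem hyperTau_shift (h_ne : h ≠ 0) (k N : ℤ) :
    hyperTau h A B k N α₀ = hyperTau h A B 0 N (h ^ k * α₀) := by
  have e : (fun l => entryG h A B l (h ^ k * α₀)) = fun l => entryG h A B (l + k) α₀ := by
    funext l; exact entryG_shift h_ne A B l k
  rw [hyperTau_eq h_ne, hyperTau_eq h_ne, e, phiDet_shift (fun l => entryG h A B l α₀) 0 k,
    zpow_zero, one_mul, zero_add]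

theorem isHypergeometricTau_hyperTau (h_ne : h ≠ 0) (h_lt : ‖h‖ < 1) (hA : IsPeriodic h A)
    (hB : IsPeriodic h B) :
    IsHypergeometricTau h {α₀ | IsGeneric h α₀} (hyperTau h A B) where
  shift k N _ _ := hyperTau_shift h_ne k N
  r1 k N _ hg := R1Rel_site h_ne hg.1 (R1Eqs_hyperTau h_ne h_lt hA hB hg k N)
  r1_inv k N _ hg := R1InvRel_site h_ne hg.1 (R1Eqs_hyperTau h_ne h_lt hA hB hg (k - 1) N)
  t4 k N _ hg := (T4Rel_site_iff h_ne hg.1).2 (T4Eqs_hyperTau h_ne h_lt hA hB hg k N)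
  t4_inv k N _ hg := (T4InvRel_site_iff h_ne hg.1).2 (T4InvEqs_hyperTau h_ne h_lt hA hB hg k N)
  boundary _ _ hN α₀ _ := hyperTau_neg _ _ _ _ hN α₀

theorem hyperTau_zero_right (h_ne : h ≠ 0) (k : ℤ) :
    hyperTau h A B k 0 α₀ = gammaFactor h k α₀ := by
  rw [hyperTau_eq h_ne, gammaFactor_eq h_ne, phiDet_zero]
  simp [gaugeM]

theorem hyperTau_one_right (h_ne : h ≠ 0) (k : ℤ) :
    hyperTau h A B k 1 α₀
      = gammaFactor h k α₀ / thetaG h (h ^ k * α₀) * entryG h A B k α₀ := by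
  have e : gaugeM h (h ^ k * α₀) 1 = (thetaG h (h ^ k * α₀))⁻¹ := by simp [gaugeM]
  rw [hyperTau_eq h_ne, gammaFactor_eq h_ne, phiDet_one, e]
  ring

/-- The entries recovered from `τ_1^k`. -/
def tauEntry (h : ℂ) (τ : ℤ → ℤ → ℂ → ℂ) (α₀ : ℂ) (k : ℤ) : ℂ :=
  τ k 1 α₀ * thetaG h (h ^ k * α₀) / gammaFactor h k α₀

variable {τ : ℤ → ℤ → ℂ → ℂ} {D : Set ℂ}

/-- Since $\tau_{-1}=0$, the first equation of $T_4^{-1}$ at level zero is linear in $\tau_1$.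
Quasi-periodicity of the theta factor turns its coefficients into those of the three-term relation.
-/
theorem threeTerm_tauEntry (h_ne : h ≠ 0) (h_lt : ‖h‖ < 1) (hτ : IsHypergeometricTau h D τ)
    (hα : α₀ ∈ D) (hg : IsGeneric h α₀) (h0 : ∀ k, τ k 0 α₀ = gammaFactor h k α₀)
    (h_nz : ∀ k, τ k 0 α₀ ≠ 0) : ThreeTerm h α₀ (tauEntry h τ α₀) := by
  intro k
  have H := ((T4InvRel_site_iff h_ne hg.1).1 (hτ.t4_inv (k + 1) 0 α₀ hα)).1
  rw [hτ.boundary _ (0 - 1) (by norm_num) α₀ hα, show k + 1 - 2 = k - 1 by ring,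
    show k + 1 - 1 = k by ring, zero_add, zpow_zero] at H
  have e1 : h ^ k * α₀ = h * (h ^ (k - 1) * α₀) := by
    rw [← mul_assoc, ← zpow_one_add₀ h_ne]; congr 2; ring
  have e2 : h ^ (k + 1) * α₀ = h * (h * (h ^ (k - 1) * α₀)) := by
    rw [zpow_add_one₀ h_ne, mul_right_comm, e1]; ring
  have hc := threeCoeff_eq (h := h) (α₀ := α₀) k
  rw [threeCoeff] at hc
  have hy := hg.shift h_ne (k - 1)
  have hθ := thetaG_ne_zero h_ne h_lt hy
  have t1 := thetaG_mul h_ne h_lt hy.1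
  have t2 := thetaG_mul h_ne h_lt (mul_ne_zero h_ne hy.1)
  have n0 := h_nz (k - 1)
  have n1 := h_nz k
  have n2 := h_nz (k + 1)
  rw [hc]
  simp only [tauEntry, ← h0, e1, e2] at H ⊢
  have y_ne := hy.1
  generalize h ^ (k - 1) * α₀ = y at *
  generalize τ (k - 1) 0 α₀ = a0 at *
  generalize τ k 0 α₀ = b0 at *
  generalize τ (k + 1) 0 α₀ = c0 at *
  generalize τ (k - 1) 1 α₀ = a1 at *
  generalize τ k 1 α₀ = b1 at *
  generalize τ (k + 1) 1 α₀ = c1 at *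
  generalize thetaG h y = θ at *
  have t1' : thetaG h (h * y) = -θ / (h ^ 2 * y ^ 6) := by
    rw [eq_div_iff (by positivity), ← t1]; ring
  have t2' : thetaG h (h * (h * y)) = θ / (h ^ 10 * y ^ 12) := by
    rw [eq_div_iff (by positivity)]
    linear_combination h ^ 2 * y ^ 6 * t2 - t1
  rw [t1', t2']
  field_simp
  refine mul_left_cancel₀ (pow_ne_zero 2 h_ne) ?_
  linear_combination -θ * H

theorem eq_hyperTau_of_eq_zero_one (h_ne : h ≠ 0) (h_lt : ‖h‖ < 1) (hA : IsPeriodic h A)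
    (hB : IsPeriodic h B) (hτ : IsHypergeometricTau h D τ) (hα : α₀ ∈ D) (hg : IsGeneric h α₀)
    (h_nz : ∀ k N, 0 ≤ N → τ k N α₀ ≠ 0) (h0 : ∀ k, τ k 0 α₀ = hyperTau h A B k 0 α₀)
    (h1 : ∀ k, τ k 1 α₀ = hyperTau h A B k 1 α₀) (k N : ℤ) :
    τ k N α₀ = hyperTau h A B k N α₀ := by
  rcases lt_or_ge N 0 with hN | hN
  · rw [hτ.boundary k N hN α₀ hα, hyperTau_neg _ _ _ _ hN]
  obtain ⟨n, rfl⟩ := Int.eq_ofNat_of_zero_le hN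
  clear hN
  suffices H : ∀ n : ℕ, (∀ k, τ k n α₀ = hyperTau h A B k n α₀) ∧
      ∀ k, τ k (n + 1 : ℤ) α₀ = hyperTau h A B k (n + 1) α₀ from (H n).1 k
  intro n
  induction n with
  | zero => simpa using ⟨h0, h1⟩
  | succ n ih =>
    obtain ⟨i0, i1⟩ := ih
    -- The second equation of $T_4$ contains the unknown $\tau_{n+2}^k$ once, multiplied by
    -- $\tau_n^{k-1}\tau_n^{k-2}\ne0$.
    refine ⟨by simpa using i1, fun k => ?_⟩
    have E := ((T4Rel_site_iff h_ne hg.1).1 (hτ.t4 k n α₀ hα)).2.1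
    have E' := (T4Eqs_hyperTau h_ne h_lt hA hB hg k n).2.1
    simp only [← i0, ← i1] at E'
    rw [← E'] at E
    have n1 := h_nz (k - 1) n (by positivity)
    have n2 := h_nz (k - 2) n (by positivity)
    have hP : (h ^ 2) ^ (n : ℤ) ≠ 0 := zpow_ne_zero _ (pow_ne_zero _ h_ne)
    have hx : h ^ k * α₀ ≠ 0 := mul_ne_zero (zpow_ne_zero _ h_ne) hg.1
    have := mul_left_cancel₀ (mul_ne_zero n1 n2) (mul_left_cancel₀ (by positivity) E)
    rwa [show ((n + 1 : ℕ) : ℤ) + 1 = n + 2 by push_cast; ring]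

theorem exists_eq_hyperTau (h_ne : h ≠ 0) (h_lt : ‖h‖ < 1)
    (hD : ∀ α₀ ∈ D, IsGeneric h α₀ ∧ ThetaNonzero h α₀) (hD' : ∀ α₀, h * α₀ ∈ D ↔ α₀ ∈ D)
    (hτ : IsHypergeometricTau h D τ) (h0 : ∀ k, ∀ α₀ ∈ D, τ k 0 α₀ = gammaFactor h k α₀)
    (h_nz : ∀ k N, 0 ≤ N → ∀ α₀ ∈ D, τ k N α₀ ≠ 0) :
    ∃ A B : ℂ → ℂ, IsPeriodic h A ∧ IsPeriodic h B ∧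
      ∀ k N, ∀ α₀ ∈ D, τ k N α₀ = hyperTau h A B k N α₀ := by
  -- The coefficients are chosen separately at each $\alpha_0$. The value zero off $D$ makes them
  -- periodic there too, because $D$ and its complement are invariant under multiplication by $h$.
  have ex : ∀ α₀, ∃ a b : ℂ, (α₀ ∉ D → a = 0 ∧ b = 0) ∧
      (α₀ ∈ D → ∀ k, tauEntry h τ α₀ k = entryG h (fun _ => a) (fun _ => b) k α₀) := by
    intro α₀
    by_cases hα : α₀ ∈ D
    · obtain ⟨hg, hΘ⟩ := hD α₀ hα
      obtain ⟨a, b, hab⟩ := exists_entryG_eq h_ne h_lt hg.1 hΘ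
        (threeTerm_tauEntry h_ne h_lt hτ hα hg (fun k => h0 k α₀ hα)
          fun k => h_nz k 0 le_rfl α₀ hα)
      exact ⟨a, b, fun hn => absurd hα hn, fun _ => hab⟩
    · exact ⟨0, 0, fun _ => ⟨rfl, rfl⟩, fun hn => absurd hn hα⟩
  choose A B hoff hon using ex
  have per : ∀ α₀, A (h * α₀) = A α₀ ∧ B (h * α₀) = B α₀ := by
    intro α₀
    by_cases hα : α₀ ∈ D
    · obtain ⟨hg, hΘ⟩ := hD α₀ hα
      -- The entry of index $k-1$ at $h\alpha_0$ and that of index $k$ at $\alpha_0$ come from the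
      -- same value of $\tau_1^0$, so the two pairs of coefficients describe the same sequence.
      refine entryG_const_injective h_ne h_lt hg.1 hΘ fun k => ?_
      have hα' := (hD' α₀).2 hα
      have e : h ^ (k - 1) * (h * α₀) = h ^ k * α₀ := by
        rw [← mul_assoc, ← zpow_add_one₀ h_ne, sub_add_cancel]
      have e1 := hon _ hα' (k - 1)
      have e2 := entryG_shift (α₀ := α₀) h_ne (fun _ => A (h * α₀)) (fun _ => B (h * α₀)) (k - 1) 1
      rw [zpow_one, sub_add_cancel] at e2
      rw [← e2, ← e1, ← hon _ hα k, tauEntry, tauEntry, gammaFactor_eq h_ne, gammaFactor_eq h_ne,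
        hτ.shift (k - 1) 1 _ hα', hτ.shift k 1 _ hα, e]
    · have hα' := mt (hD' α₀).1 hα
      simp [hoff _ hα, hoff _ hα']
  have hA : IsPeriodic h A := fun α₀ => (per α₀).1
  have hB : IsPeriodic h B := fun α₀ => (per α₀).2
  refine ⟨A, B, hA, hB, fun k N α₀ hα => ?_⟩
  obtain ⟨hg, hΘ⟩ := hD α₀ hα
  refine eq_hyperTau_of_eq_zero_one h_ne h_lt hA hB hτ hα hg (fun k N hN => h_nz k N hN α₀ hα)
    (fun k => by rw [h0 k α₀ hα, hyperTau_zero_right h_ne]) (fun k => ?_) k N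
  have e : entryG h A B k α₀ = entryG h (fun _ => A α₀) (fun _ => B α₀) k α₀ := by
    simp only [entryG, hA.zpow_mul h_ne, hB.zpow_mul h_ne]
  rw [hyperTau_one_right h_ne, e, ← hon α₀ hα k, tauEntry]
  have hΓ : gammaFactor h k α₀ ≠ 0 := by rw [← h0 k α₀ hα]; exact h_nz k 0 le_rfl α₀ hα
  have hθ := thetaG_ne_zero h_ne h_lt (hg.shift h_ne k)
  field_simp

end Hypergeometric

end QPainleve

end

theorem mainTheorem3 (h : ℂ) (h_ne : h ≠ 0) (h_lt : ‖h‖ < 1) :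
    -- the entries `G_k` solve the three-term relation and are its general solution
    (∀ A B : ℂ → ℂ, QPainleve.IsPeriodic h A → QPainleve.IsPeriodic h B →
      ∀ α₀ : ℂ, α₀ ≠ 0 →
        QPainleve.ThreeTerm h α₀ (fun k => QPainleve.entryG h A B k α₀)) ∧
    (∀ α₀ : ℂ, α₀ ≠ 0 → QPainleve.ThetaNonzero h α₀ →
      ∀ G : ℤ → ℂ, QPainleve.ThreeTerm h α₀ G →
        ∃ a b : ℂ, ∀ k : ℤ, G k = QPainleve.entryG h (fun _ => a) (fun _ => b) k α₀) ∧
    -- the explicit functions are hypergeometric `τ` functions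
    (∀ A B : ℂ → ℂ, QPainleve.IsPeriodic h A → QPainleve.IsPeriodic h B →
      QPainleve.IsHypergeometricTau h {α₀ | QPainleve.IsGeneric h α₀}
        (QPainleve.hyperTau h A B)) ∧
    -- every normalized hypergeometric `τ` function is of the explicit form
    (∀ D : Set ℂ,
      (∀ α₀ ∈ D, QPainleve.IsGeneric h α₀ ∧ QPainleve.ThetaNonzero h α₀) →
      (∀ α₀ : ℂ, h * α₀ ∈ D ↔ α₀ ∈ D) →
      ∀ τ : ℤ → ℤ → ℂ → ℂ, QPainleve.IsHypergeometricTau h D τ →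
        (∀ k : ℤ, ∀ α₀ ∈ D, τ k 0 α₀ = QPainleve.gammaFactor h k α₀) →
        (∀ k N : ℤ, 0 ≤ N → ∀ α₀ ∈ D, τ k N α₀ ≠ 0) →
        ∃ A B : ℂ → ℂ, QPainleve.IsPeriodic h A ∧ QPainleve.IsPeriodic h B ∧
          ∀ k N : ℤ, ∀ α₀ ∈ D, τ k N α₀ = QPainleve.hyperTau h A B k N α₀) :=
  ⟨fun _ _ hA hB _ hα => QPainleve.threeTerm_entryG h_ne h_lt hA hB hα,
    fun _ hα hΘ _ hG => QPainleve.exists_entryG_eq h_ne h_lt hα hΘ hG,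
    fun _ _ hA hB => QPainleve.isHypergeometricTau_hyperTau h_ne h_lt hA hB,
    fun _ hD hD' _ hτ h0 h_nz => QPainleve.exists_eq_hyperTau h_ne h_lt hD hD' hτ h0 h_nz⟩
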